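/- Let $M$ be a smooth manifold of dimension $n$ and let $L$ be an $n$-dimensional real Lie algebra of smooth vector fields on $M$ whose values span $T_xM$ at every point $x\in M$. Let $\Gamma\in L$, put $L_{\Gamma,0}=L$ and $$L_{\Gamma,i+1}=\langle\Gamma\rangle+[L_{\Gamma,i},L_{\Gamma,i}]\qquad(i\ge 0),$$ and suppose that $L_{\Gamma,k}$ is Abelian for some $k\ge 0$ (if $k$ is the smallest such index, $(M,L,\Gamma)$ is called Lie integrable of order $k+1$). Then the flow of $\Gamma$ can be found locally, in arbitrary initial coordinates, by $k+1$ quadratures, in the following sense. *Terminology.* A function on an open subset of some $\mathbb R^m$ is elementary in a set of known functions if it is obtained from them, from constants and from the coordinate functions by finitely many additions, multiplications, inversions of nowhere vanishing functions, substitutions, partial differentiations, inversions of local diffeomorphisms between open subsets of $\mathbb R^m$, and restrictions to open subsets. A quadrature of a function $h$ is a function $F(x_1,\dots,x_m)=\int_a^{x_i}h(x_1,\dots,s,\dots,x_m)\,ds$ on an open set ($s$ in the $i$-th place, $a$ a constant, the other variables being parameters). A sequence of quadratures $F_1,F_2,\dots$ from given data is one in which each $F_l$ is a quadrature of a function elementary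 in the data and $F_1,\dots,F_{l-1}$. For $0\le i<k$ let $A_i\subset L_{\Gamma,i}^*$ be the annihilator of $L_{\Gamma,i+1}$, let $A_k=L_{\Gamma,k}^*$, and let $\Xi=A_0\oplus\dots\oplus A_k$; for $\xi=(\zeta_0,\dots,\zeta_k)\in\Xi$ put $\xi(\Gamma)=\sum_i\zeta_i(\Gamma)$. *Claim.* $\dim\Xi=n$, and for every $x_0\in M$ and every smooth chart $\varphi$ around $x_0$ there are an open neighbourhood $U$ of $x_0$ in the domain of $\varphi$, a sequence of $k+1$ quadratures $F_1,\dots,F_{k+1}$ from the components of the elements of $L$ in the chart $\varphi$, and linear maps $A_i\ni\zeta\mapsto Q_\zeta\in C^\infty(U)$ ($0\le i\le k$) such that: 1. for $\zeta\in A_i$ one has $XQ_\zeta=\zeta(X)$ on $U$ for all $X\in L_{\Gamma,i}$, and $Q_\zeta$, expressed in the chart $\varphi$, is elementary in the data and $F_1,\dots,F_{i+1}$; 2. with $Q_\xi=\sum_iQ_{\zeta_i}$ for $\xi=(\zeta_0,\dots,\zeta_k)$, for every basis $\xi_1,\dots,\xi_n$ of $\Xi$ the functions $Q_{\xi_1},\dots,Q_{\xi_n}$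 are smooth coordinates on $U$, and $\Gamma$ has constant components in them: $\Gamma Q_\xi=\xi(\Gamma)$ on $U$ for all $\xi\in\Xi$; 3. there are an open neighbourhood $V\subset U$ of $x_0$, an $\varepsilon>0$ and a local flow $\Phi_t:V\to U$ ($|t|<\varepsilon$) of $\Gamma$, i.e. $t\mapsto\Phi_t(x)$ is an integral curve of $\Gamma$ with $\Phi_0(x)=x$, such that every integral curve $\gamma:(-\delta,\delta)\to U$ of $\Gamma$ with $0<\delta\le\varepsilon$ and $\gamma(0)\in V$ is $t\mapsto\Phi_t(\gamma(0))$; moreover $Q_\xi(\Phi_t(x))=Q_\xi(x)+\xi(\Gamma)\,t$ for all $\xi\in\Xi$, and the components of $\Phi_t(x)$ in the chart $\varphi$, as functions of $t$ and of the coordinates of $x$, are elementary in the data and $F_1,\dots,F_{k+1}$. -/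

import Mathlib

open Set Topology VectorField
open scoped Manifold ContDiff

noncomputable section

/-! ### Functions obtained by elementary operations and quadratures -/

/-- A real function of finitely many real variables, with a domain of definition. -/
structure LocFun where
  arity : ℕ
  dom : Set (Fin arity → ℝ)
  fn : (Fin arity → ℝ) → ℝ

/-- `IsElementary 𝓕 V f`: on the open set `V ⊆ ℝᵐ` the function `f` is obtained from the known functions
in `𝓕` without any integration, that is, by algebraic operations, substitution, partial
differentiation and inversion (elimination). Elimination of unknowns `y` from `G (p, y) = c` is the
inversion of `(p, y) ↦ (p, G (p, y))`. -/
inductive IsElementary (𝓕 : Set LocFun) : {m : ℕ} → Set (Fin m → ℝ) → ((Fin m → ℝ) → ℝ) → Prop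
  | base {m : ℕ} {V : Set (Fin m → ℝ)} {f : (Fin m → ℝ) → ℝ} :
      LocFun.mk m V f ∈ 𝓕 → IsOpen V → IsElementary 𝓕 V f
  | const {m : ℕ} {V : Set (Fin m → ℝ)} (c : ℝ) : IsOpen V → IsElementary 𝓕 V (fun _ => c)
  | coord {m : ℕ} {V : Set (Fin m → ℝ)} (i : Fin m) : IsOpen V → IsElementary 𝓕 V (fun x => x i)
  | add {m : ℕ} {V : Set (Fin m → ℝ)} {f g : (Fin m → ℝ) → ℝ} :
      IsElementary 𝓕 V f → IsElementary 𝓕 V g → IsElementary 𝓕 V (fun x => f x + g x)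
  | mul {m : ℕ} {V : Set (Fin m → ℝ)} {f g : (Fin m → ℝ) → ℝ} :
      IsElementary 𝓕 V f → IsElementary 𝓕 V g → IsElementary 𝓕 V (fun x => f x * g x)
  | inv {m : ℕ} {V : Set (Fin m → ℝ)} {f : (Fin m → ℝ) → ℝ} :
      IsElementary 𝓕 V f → (∀ x ∈ V, f x ≠ 0) → IsElementary 𝓕 V (fun x => (f x)⁻¹)
  | comp {m p : ℕ} {V : Set (Fin m → ℝ)} {W : Set (Fin p → ℝ)} {g : (Fin p → ℝ) → ℝ}
      {u : Fin p → (Fin m → ℝ) → ℝ} :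
      IsOpen V → IsElementary 𝓕 W g → (∀ i, IsElementary 𝓕 V (u i)) → (∀ x ∈ V, (fun i => u i x) ∈ W) →
        IsElementary 𝓕 V (fun x => g (fun i => u i x))
  | pderiv {m : ℕ} {V : Set (Fin m → ℝ)} {f : (Fin m → ℝ) → ℝ} (i : Fin m) :
      IsElementary 𝓕 V f → IsElementary 𝓕 V (fun x => fderiv ℝ f x (Pi.single i 1))
  | inverse {m : ℕ} (e : OpenPartialHomeomorph (Fin m → ℝ) (Fin m → ℝ)) :
      (∀ i, IsElementary 𝓕 e.source (fun x => e x i)) →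
      (∀ x ∈ e.source, (fderiv ℝ e x).IsInvertible) →
        ∀ i, IsElementary 𝓕 e.target (fun y => e.symm y i)
  | congr {m : ℕ} {V : Set (Fin m → ℝ)} {f g : (Fin m → ℝ) → ℝ} :
      IsElementary 𝓕 V f → EqOn f g V → IsElementary 𝓕 V g

/-- `F`, on the open set `V`, is a quadrature of `h : D → ℝ` in the `i`-th variable, the other
variables being parameters: `F x = ∫_a^{x_i} h (x_1, …, s, …, x_m) ds`. -/
def IsQuadrature {m : ℕ} (i : Fin m) (D : Set (Fin m → ℝ)) (h : (Fin m → ℝ) → ℝ)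
    (V : Set (Fin m → ℝ)) (F : (Fin m → ℝ) → ℝ) : Prop :=
  IsOpen V ∧ ∃ a : ℝ, ∀ x ∈ V,
    (∀ s ∈ uIcc a (x i), Function.update x i s ∈ D) ∧
      F x = ∫ s in a..(x i), h (Function.update x i s)

/-- The data `𝓑` together with the first `l` members of a sequence of functions. -/
def available (𝓑 : Set LocFun) (F : ℕ → LocFun) (l : ℕ) : Set LocFun :=
  𝓑 ∪ F '' {j | j < l}

/-- `F 0, …, F (r - 1)` are the results of `r` successive quadratures starting from the data `𝓑`:
each is one quadrature of a function that is elementary in the data and the preceding ones. -/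
def IsQuadratureSequence (𝓑 : Set LocFun) (r : ℕ) (F : ℕ → LocFun) : Prop :=
  ∀ l < r, ∃ (D : Set (Fin (F l).arity → ℝ)) (h : (Fin (F l).arity → ℝ) → ℝ)
    (i : Fin (F l).arity),
      IsElementary (available 𝓑 F l) D h ∧ IsQuadrature i D h (F l).dom (F l).fn

/-! ### Lie algebras of vector fields -/

/-- Euclidean `n`-space. -/
abbrev Eu (n : ℕ) : Type := EuclideanSpace ℝ (Fin n)

variable {n : ℕ} {M : Type*} [TopologicalSpace M] [ChartedSpace (Eu n) M]

/-- (Not necessarily smooth) vector fields on the `n`-dimensional manifold `M`. -/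
abbrev VecField (n : ℕ) (M : Type*) [TopologicalSpace M] [ChartedSpace (Eu n) M] : Type _ :=
  (x : M) → TangentSpace 𝓘(ℝ, Eu n) x

/-- The derivative `X f` of a function along a vector field. -/
def along (X : VecField n M) (f : M → ℝ) (x : M) : ℝ :=
  mfderiv 𝓘(ℝ, Eu n) 𝓘(ℝ, ℝ) f x (X x)

/-- `L` is a real Lie algebra of smooth vector fields on the `n`-dimensional manifold `M`, of
dimension `n`, whose values span every tangent space. -/
structure IsFrameLieAlgebra [IsManifold 𝓘(ℝ, Eu n) ∞ M]
    (L : Submodule ℝ (VecField n M)) : Prop where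
  smooth : ∀ X ∈ L, ContMDiff 𝓘(ℝ, Eu n) 𝓘(ℝ, Eu n).tangent ∞
    (fun x => (⟨x, X x⟩ : TangentBundle 𝓘(ℝ, Eu n) M))
  lie_mem : ∀ X ∈ L, ∀ Y ∈ L, mlieBracket 𝓘(ℝ, Eu n) X Y ∈ L
  finiteDimensional : FiniteDimensional ℝ L
  finrank_eq : Module.finrank ℝ L = n
  span_eq : ∀ (x : M) (v : TangentSpace 𝓘(ℝ, Eu n) x), ∃ X ∈ L, X x = v

/-- The sequence `L_{Γ,0} = L`, `L_{Γ,i+1} = ⟨Γ⟩ + [L_{Γ,i}, L_{Γ,i}]`. -/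
def lieSeq (L : Submodule ℝ (VecField n M)) (Γ : VecField n M) :
    ℕ → Submodule ℝ (VecField n M)
  | 0 => L
  | i + 1 => Submodule.span ℝ {Γ} ⊔
      Submodule.span ℝ {Z | ∃ X ∈ lieSeq L Γ i, ∃ Y ∈ lieSeq L Γ i,
        Z = mlieBracket 𝓘(ℝ, Eu n) X Y}

/-- All brackets of elements of `A` vanish. -/
def IsAbelianSpace (A : Submodule ℝ (VecField n M)) : Prop :=
  ∀ X ∈ A, ∀ Y ∈ A, mlieBracket 𝓘(ℝ, Eu n) X Y = 0

theorem mem_lieSeq {L : Submodule ℝ (VecField n M)} {Γ : VecField n M} (hΓ : Γ ∈ L) (i : ℕ) :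
    Γ ∈ lieSeq L Γ i := by
  cases i with
  | zero => exact hΓ
  | succ i => exact Submodule.mem_sup_left (Submodule.mem_span_singleton_self Γ)

/-- The linear forms used at stage `i`: for `i < k` the annihilator of `L_{Γ,i+1}` in the dual
of `L_{Γ,i}`, and for `i = k` the whole dual of `L_{Γ,k}`. -/
def stageDual (L : Submodule ℝ (VecField n M)) (Γ : VecField n M) (k i : ℕ) :
    Submodule ℝ (Module.Dual ℝ (lieSeq L Γ i)) where
  carrier := {ζ | i < k → ∀ X : lieSeq L Γ i, X.1 ∈ lieSeq L Γ (i + 1) → ζ X = 0}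
  add_mem' := fun ha hb hi X hX => by simp [ha hi X hX, hb hi X hX]
  zero_mem' := fun _ _ _ => rfl
  smul_mem' := fun c _ ha hi X hX => by simp [ha hi X hX]

/-- The formal direct sum `Ξ` of the spaces of linear forms of all the stages `0, …, k`. -/
abbrev StageSum (L : Submodule ℝ (VecField n M)) (Γ : VecField n M) (k : ℕ) : Type _ :=
  (i : Fin (k + 1)) → stageDual L Γ k i

/-- `ξ(Γ)` for `ξ ∈ Ξ`. -/
def evalAt {L : Submodule ℝ (VecField n M)} {Γ : VecField n M} (hΓ : Γ ∈ L) {k : ℕ}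
    (ξ : StageSum L Γ k) : ℝ :=
  ∑ i, (ξ i).1 ⟨Γ, mem_lieSeq hΓ i⟩

/-- The extension `ξ ↦ Q_ξ` to `Ξ` of linear maps `ζ ↦ Q_ζ` given stage by stage. -/
def totalQ {L : Submodule ℝ (VecField n M)} {Γ : VecField n M} {k : ℕ}
    (Q : (i : Fin (k + 1)) → stageDual L Γ k i →ₗ[ℝ] (M → ℝ)) (ξ : StageSum L Γ k) : M → ℝ :=
  fun x => ∑ i, Q i (ξ i) x

/-- The data of the problem in the coordinates of a chart `φ`: the components
`y ↦ (X φʲ)(φ⁻¹ y)` of the vector fields `X ∈ L`. -/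
def fieldData (L : Submodule ℝ (VecField n M)) (φ : OpenPartialHomeomorph M (Eu n)) :
    Set LocFun :=
  {B | ∃ X ∈ L, ∃ j : Fin n,
    B = ⟨n, {y | WithLp.toLp 2 y ∈ φ.target},
      fun y => along X (fun x => φ x j) (φ.symm (WithLp.toLp 2 y))⟩}

end

/-! Write `L_i` for `lieSeq L Γ i`. These spaces decrease and `[L_i, L_i] ⊆ L_{i+1}`. Choose a basis
`b_j` of `L` adapted to the flag `L_0 ⊇ … ⊇ L_k`, where `lev j` is the last index `i ≤ k` with `b_j
∈ L_i`, and let `θ_j` be the dual coframe. A form `θ_m` of level `i` is constant on the fields of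
`L_i` and kills their brackets: these lie in `L_{i+1}` for `i < k` and vanish for `i = k`. Since
`dθ(X, Y) = X θ(Y) - Y θ(X) - θ([X, Y])`, the form `θ_m` is closed along the distribution spanned by
`L_i`, and so has primitives along its leaves (`fderiv_coframe_symm`, `fderiv_leafIntegral_apply`).

The leaves are known once the earlier stages are done. The primitives of level less than `i` are
annihilated by `L_i`, so in coordinates containing them the leaves are parallel affine pieces. A
primitive of level `i` is then the integral of `θ_m` along a segment in the leaf, the transversal
variables being parameters. Replacing the coordinates of level `i` by these primitives gives the
coordinates of the next stage (`IsStagedChart.exists_succ`). The coordinates are normalised at the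
base point so that this replacement has identity differential there, and the inverse function
theorem applies. All the forms of one level cost a single quadrature: their coefficients in a
general linear combination are added to the variables of the integrand (`leafQuadrature`). Inverting
the coordinates and the frame matrix is elementary.

After `k + 1` stages every coordinate has a constant derivative along `Γ`, because `Γ` belongs to
every `L_i`. The flow is a translation in these coordinates, and it is brought back to the initial
chart by substitution and inversion (`IsStagedChart.isElementary_pulledFlow`). Evaluation on the
adapted basis identifies `Ξ` with `ℝⁿ` (`IsAdaptedBasis.values_bijective`), so the functions `Q_ξ`
are the linear combinations of the final coordinates, and a basis of `Ξ` amounts to a linear change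
of them. -/

open Set Topology VectorField
open scoped Manifold ContDiff

noncomputable section

/-! ### Closure properties of elementary functions. -/

namespace IsElementary

variable {𝓕 𝓖 : Set LocFun} {m : ℕ} {V W : Set (Fin m → ℝ)} {f g : (Fin m → ℝ) → ℝ}

theorem isOpen (h : IsElementary 𝓕 V f) : IsOpen V := by
  induction h with
  | base _ h => exact h
  | const _ h => exact h
  | coord _ h => exact h
  | add _ _ h _ => exact h
  | mul _ _ h _ => exact h
  | inv _ _ h => exact h
  | comp h => exact h
  | pderiv _ _ h => exact h
  | inverse e => exact e.open_target
  | congr _ _ h => exact h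

theorem mono (hFG : 𝓕 ⊆ 𝓖) (h : IsElementary 𝓕 V f) : IsElementary 𝓖 V f := by
  induction h with
  | base h hV => exact .base (hFG h) hV
  | const c h => exact .const c h
  | coord i h => exact .coord i h
  | add _ _ h h' => exact .add h h'
  | mul _ _ h h' => exact .mul h h'
  | inv _ hn h => exact .inv h hn
  | comp hV _ _ hm h h' => exact .comp hV h h' hm
  | pderiv i _ h => exact .pderiv i h
  | inverse e _ hi i h => exact .inverse e h hi i
  | congr _ he h => exact .congr h he

/-- Restriction is substitution of the coordinate functions, which are elementary on every open set.
-/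
theorem restrict (h : IsElementary 𝓕 V f) (hW : IsOpen W) (hWV : W ⊆ V) : IsElementary 𝓕 W f :=
  .comp (u := fun i x => x i) hW h (fun i => .coord i hW) hWV

theorem const_mul (c : ℝ) (h : IsElementary 𝓕 V f) : IsElementary 𝓕 V (fun x => c * f x) :=
  .mul (.const c h.isOpen) h

theorem neg (h : IsElementary 𝓕 V f) : IsElementary 𝓕 V (fun x => -f x) :=
  (h.const_mul (-1)).congr fun x _ => by ring

theorem sub (h : IsElementary 𝓕 V f) (h' : IsElementary 𝓕 V g) :
    IsElementary 𝓕 V (fun x => f x - g x) :=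
  (h.add h'.neg).congr fun x _ => by ring

theorem sum {ι : Type*} (hV : IsOpen V) (s : Finset ι) {u : ι → (Fin m → ℝ) → ℝ}
    (h : ∀ i ∈ s, IsElementary 𝓕 V (u i)) : IsElementary 𝓕 V (fun x => ∑ i ∈ s, u i x) := by
  classical
  induction s using Finset.induction_on with
  | empty => simpa using IsElementary.const (𝓕 := 𝓕) 0 hV
  | insert a s ha ih =>
    simp only [Finset.sum_insert ha]
    exact (h a (by simp)).add (ih fun i hi => h i (by simp [hi]))

theorem prod {ι : Type*} (hV : IsOpen V) (s : Finset ι) {u : ι → (Fin m → ℝ) → ℝ}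
    (h : ∀ i ∈ s, IsElementary 𝓕 V (u i)) : IsElementary 𝓕 V (fun x => ∏ i ∈ s, u i x) := by
  classical
  induction s using Finset.induction_on with
  | empty => simpa using IsElementary.const (𝓕 := 𝓕) 1 hV
  | insert a s ha ih =>
    simp only [Finset.prod_insert ha]
    exact (h a (by simp)).mul (ih fun i hi => h i (by simp [hi]))

theorem matrix_det {ι : Type*} [Fintype ι] [DecidableEq ι] (hV : IsOpen V)
    {A : (Fin m → ℝ) → Matrix ι ι ℝ} (h : ∀ i j, IsElementary 𝓕 V (fun x => A x i j)) :
    IsElementary 𝓕 V (fun x => (A x).det) := by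
  simp only [Matrix.det_apply']
  exact .sum hV _ fun σ _ => .const_mul _ (.prod hV _ fun i _ => h _ _)

/-- Cramer's rule: the entries of the adjugate are determinants, hence polynomials in the entries.
-/
theorem matrix_inv {ι : Type*} [Fintype ι] [DecidableEq ι] (hV : IsOpen V)
    {A : (Fin m → ℝ) → Matrix ι ι ℝ} (h : ∀ i j, IsElementary 𝓕 V (fun x => A x i j))
    (hA : ∀ x ∈ V, (A x).det ≠ 0) (i j : ι) : IsElementary 𝓕 V (fun x => (A x)⁻¹ i j) := by
  have hadj : IsElementary 𝓕 V (fun x => (A x).adjugate i j) := by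
    simp only [Matrix.adjugate_apply]
    refine matrix_det hV fun a b => ?_
    by_cases ha : a = j
    · subst ha
      simpa using IsElementary.const _ hV
    · simpa [Matrix.updateRow_apply, ha] using h a b
  refine (((matrix_det hV h).inv hA).mul hadj).congr fun x _ => ?_
  simp [Matrix.inv_def, Ring.inverse_eq_inv']

theorem fderiv_apply (h : IsElementary 𝓕 V f) {X : (Fin m → ℝ) → Fin m → ℝ}
    (hX : ∀ i, IsElementary 𝓕 V (fun x => X x i)) :
    IsElementary 𝓕 V (fun x => fderiv ℝ f x (X x)) := by
  refine (sum h.isOpen Finset.univ fun i _ => (hX i).mul (.pderiv i h)).congr fun x _ => ?_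
  conv_rhs => rw [pi_eq_sum_univ' (X x)]
  simp [map_sum]

end IsElementary

theorem available_mono {𝓑 : Set LocFun} {F : ℕ → LocFun} {l l' : ℕ} (h : l ≤ l') :
    available 𝓑 F l ⊆ available 𝓑 F l' :=
  union_subset_union_right _ (image_mono fun _ hj => lt_of_lt_of_le hj h)

theorem available_congr {𝓑 : Set LocFun} {F G : ℕ → LocFun} {l : ℕ} (h : ∀ j < l, F j = G j) :
    available 𝓑 F l = available 𝓑 G l := by
  unfold available
  congr 1
  exact image_congr fun j hj => h j hj

universe u

/-! ### Smooth dependence of integrals on parameters. -/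

section ParametricIntegral

variable {E G : Type u} [NormedAddCommGroup E] [NormedSpace ℝ E] [NormedAddCommGroup G]
  [NormedSpace ℝ G]

open MeasureTheory in
theorem hasFDerivAt_intervalIntegral_of_contDiffOn {O : Set (E × ℝ)} (hO : IsOpen O)
    {f : E × ℝ → G} (hf : ContDiffOn ℝ 1 f O) {x₀ : E} (hx : ∀ s ∈ Icc (0 : ℝ) 1, (x₀, s) ∈ O) :
    HasFDerivAt (fun x => ∫ s in (0 : ℝ)..1, f (x, s))
      (∫ s in (0 : ℝ)..1, (fderiv ℝ f (x₀, s)).comp (.inl ℝ E ℝ)) x₀ := by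
  have hc : ContinuousOn (fun p => (fderiv ℝ f p).comp (.inl ℝ E ℝ)) O :=
    (hf.continuousOn_fderiv_of_isOpen hO le_rfl).clm_comp continuousOn_const
  have hcurve (x : E) : Continuous fun s : ℝ => (x, s) := by fun_prop
  -- A bound on the compact segment over `x₀`, relaxed to `C + 1`, persists over a whole
  -- neighbourhood of `x₀` by the tube lemma. This constant dominates the differentiated integrand.
  obtain ⟨C, hC⟩ : ∃ C, ∀ s ∈ Icc (0 : ℝ) 1, ‖(fderiv ℝ f (x₀, s)).comp (.inl ℝ E ℝ)‖ ≤ C :=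
    isCompact_Icc.exists_bound_of_continuousOn (hc.comp (hcurve x₀).continuousOn hx)
  have hO' : IsOpen (O ∩ {p | ‖(fderiv ℝ f p).comp (.inl ℝ E ℝ)‖ < C + 1}) :=
    hc.norm.isOpen_inter_preimage hO isOpen_Iio
  obtain ⟨u, v, hu, -, hxu, hv, huv⟩ := generalized_tube_lemma (isCompact_singleton (x := x₀))
    (isCompact_Icc (a := (0 : ℝ)) (b := 1)) hO' (by
      rintro ⟨x, s⟩ ⟨rfl, hs⟩
      exact ⟨hx s hs, (hC s hs).trans_lt (lt_add_one C)⟩)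
  have hmem : ∀ x ∈ u, ∀ s ∈ uIcc (0 : ℝ) 1, (x, s) ∈ O ∧
      ‖(fderiv ℝ f (x, s)).comp (.inl ℝ E ℝ)‖ < C + 1 := fun x hxu s hs =>
    huv ⟨hxu, hv (by rwa [uIcc_of_le zero_le_one] at hs)⟩
  have hu' : u ∈ 𝓝 x₀ := hu.mem_nhds (hxu rfl)
  have hint : ∀ x ∈ u, IntervalIntegrable (fun s => f (x, s)) volume 0 1 := fun x hxu =>
    (hf.continuousOn.comp (hcurve x).continuousOn fun s hs =>
      (hmem x hxu s hs).1).intervalIntegrable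
  refine intervalIntegral.hasFDerivAt_integral_of_dominated_of_fderiv_le
    (F := fun x s => f (x, s)) (F' := fun x s => (fderiv ℝ f (x, s)).comp (.inl ℝ E ℝ))
    (bound := fun _ => C + 1) hu' ?_ (hint x₀ (hxu rfl)) ?_ ?_ intervalIntegrable_const ?_
  · filter_upwards [hu'] with x hxu
    exact (intervalIntegrable_iff.1 (hint x hxu)).aestronglyMeasurable
  · refine (intervalIntegrable_iff.1 (ContinuousOn.intervalIntegrable ?_)).aestronglyMeasurable
    exact hc.comp (hcurve x₀).continuousOn fun s hs => (hmem x₀ (hxu rfl) s hs).1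
  · exact .of_forall fun s hs x hxu => (hmem x hxu s (uIoc_subset_uIcc hs)).2.le
  · refine .of_forall fun s hs x hxu => ?_
    have h1 := ((hf.contDiffAt (hO.mem_nhds (hmem x hxu s (uIoc_subset_uIcc hs)).1)).differentiableAt
      one_ne_zero).hasFDerivAt
    exact h1.comp x (hasFDerivAt_prodMk_left x s)

theorem contDiffOn_intervalIntegral {O : Set (E × ℝ)} (hO : IsOpen O) {f : E × ℝ → G}
    (hf : ContDiffOn ℝ ∞ f O) {U : Set E} (hU : IsOpen U)
    (hUO : ∀ x ∈ U, ∀ s ∈ Icc (0 : ℝ) 1, (x, s) ∈ O) :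
    ContDiffOn ℝ ∞ (fun x => ∫ s in (0 : ℝ)..1, f (x, s)) U := by
  rw [contDiffOn_infty]
  intro N
  -- The derivative of the integral is again such an integral, with values in `E →L[ℝ] G`. Hence `G`
  -- varies in the induction, and `E` and `G` share a universe.
  induction N generalizing G with
  | zero =>
    refine contDiffOn_zero.2 fun x hx => ContinuousAt.continuousWithinAt ?_
    exact (hasFDerivAt_intervalIntegral_of_contDiffOn hO (hf.of_le (by norm_cast)) (hUO x hx)).continuousAt
  | succ N ih =>
    have hd := fun x hx => hasFDerivAt_intervalIntegral_of_contDiffOn hO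
      (hf.of_le (by norm_cast : (1 : ℕ∞ω) ≤ ∞)) (hUO x hx)
    push_cast
    rw [contDiffOn_succ_iff_fderiv_of_isOpen hU]
    refine ⟨fun x hx => (hd x hx).differentiableAt.differentiableWithinAt, by simp, ?_⟩
    refine (ih (f := fun p => (fderiv ℝ f p).comp (.inl ℝ E ℝ)) ?_).congr
      fun x hx => (hd x hx).fderiv
    exact (hf.fderiv_of_isOpen hO (by norm_cast)).clm_comp contDiffOn_const

end ParametricIntegral

/-! ### Primitives of one-forms along the affine leaves `w + range π`. -/

section LeafIntegral

variable {E : Type} [NormedAddCommGroup E] [NormedSpace ℝ E]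

/-- The integral of the one-form `θ` along the segment from `w - π w` to `w`. -/
def leafIntegral (π : E →L[ℝ] E) (θ : E → E →L[ℝ] ℝ) (w : E) : ℝ :=
  ∫ s in (0 : ℝ)..1, θ (w - π w + s • π w) (π w)

variable {π : E →L[ℝ] E} {θ : E → E →L[ℝ] ℝ} {B : Set E}

theorem leafIntegral_of_apply_eq_zero {w : E} (hw : π w = 0) : leafIntegral π θ w = 0 := by
  simp [leafIntegral, hw]

theorem Convex.sub_add_smul_mem_of_mem (hB : Convex ℝ B) {w : E} (hw : w ∈ B) (hw' : w - π w ∈ B)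
    {s : ℝ} (hs : s ∈ Icc (0 : ℝ) 1) : w - π w + s • π w ∈ B := by
  have := hB hw' hw (sub_nonneg.2 hs.2) hs.1 (by ring)
  convert this using 1
  module

theorem isOpen_leafDomain (hB : IsOpen B) : IsOpen {w | w ∈ B ∧ w - π w ∈ B} :=
  hB.inter (hB.preimage (by fun_prop))

theorem isOpen_setOf_sub_add_smul_mem (hB : IsOpen B) :
    IsOpen {p : E × ℝ | p.1 - π p.1 + p.2 • π p.1 ∈ B} :=
  hB.preimage (by fun_prop)

theorem contDiffOn_leafIntegrand (hθ : ContDiffOn ℝ ∞ θ B) :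
    ContDiffOn ℝ ∞ (fun p : E × ℝ => θ (p.1 - π p.1 + p.2 • π p.1) (π p.1))
      {p | p.1 - π p.1 + p.2 • π p.1 ∈ B} :=
  (hθ.comp (t := B) (g := θ) (f := fun p : E × ℝ => p.1 - π p.1 + p.2 • π p.1)
    (ContDiff.contDiffOn (by fun_prop)) fun _ hp => hp).clm_apply
      (ContDiff.contDiffOn (by fun_prop))

theorem contDiffOn_leafIntegral (hB : IsOpen B) (hBc : Convex ℝ B) (hθ : ContDiffOn ℝ ∞ θ B) :
    ContDiffOn ℝ ∞ (leafIntegral π θ) {w | w ∈ B ∧ w - π w ∈ B} :=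
  contDiffOn_intervalIntegral (isOpen_setOf_sub_add_smul_mem hB) (contDiffOn_leafIntegrand hθ)
    (isOpen_leafDomain hB) fun _ hw _ hs => hBc.sub_add_smul_mem_of_mem hw.1 hw.2 hs

/-- The Poincaré lemma on each leaf. Differentiating the integrand in the direction `π v` and using
the symmetry of the derivative of `θ` on the leaf turns it into the `s`-derivative of `s * θ (w - π
w + s • π w) (π v)`, which integrates to `θ w (π v)`. -/
theorem fderiv_leafIntegral_apply (hB : IsOpen B) (hBc : Convex ℝ B) (hθ : ContDiffOn ℝ ∞ θ B)
    (hπ : ∀ v, π (π v) = π v)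
    (hsymm : ∀ w ∈ B, ∀ u v, fderiv ℝ θ w (π u) (π v) = fderiv ℝ θ w (π v) (π u))
    {w : E} (hw : w ∈ B) (hw' : w - π w ∈ B) (v : E) :
    fderiv ℝ (leafIntegral π θ) w (π v) = θ w (π v) := by
  have hmem : ∀ s ∈ Icc (0 : ℝ) 1, w - π w + s • π w ∈ B := fun s hs =>
    hBc.sub_add_smul_mem_of_mem hw hw' hs
  have hmem' : ∀ s ∈ uIcc (0 : ℝ) 1, w - π w + s • π w ∈ B := fun s hs =>
    hmem s (by rwa [uIcc_of_le zero_le_one] at hs)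
  have hO := isOpen_setOf_sub_add_smul_mem (π := π) hB
  have hf := (contDiffOn_leafIntegrand (π := π) hθ).of_le (by norm_cast : (1 : ℕ∞ω) ≤ ∞)
  have hd := hasFDerivAt_intervalIntegral_of_contDiffOn hO hf (x₀ := w) hmem
  have hθd : ∀ x ∈ B, HasFDerivAt θ (fderiv ℝ θ x) x := fun x hx =>
    ((hθ.contDiffAt (hB.mem_nhds hx)).differentiableAt (by simp)).hasFDerivAt
  have hcur : ∀ s, HasDerivAt (fun s : ℝ => w - π w + s • π w) (π w) s := fun s => by
    simpa using! ((hasDerivAt_id s).smul_const (π w)).const_add (w - π w)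
  have hval : ∀ s ∈ uIcc (0 : ℝ) 1,
      (fderiv ℝ (fun p : E × ℝ => θ (p.1 - π p.1 + p.2 • π p.1) (π p.1)) (w, s)).comp
        (.inl ℝ E ℝ) (π v) = s * fderiv ℝ θ (w - π w + s • π w) (π w) (π v)
          + θ (w - π w + s • π w) (π v) := fun s hs => by
    have h1 : HasFDerivAt (fun x : E => x - π x + s • π x)
        (ContinuousLinearMap.id ℝ E - π + s • π) w := by
      exact ((hasFDerivAt_id w).sub π.hasFDerivAt).add (π.hasFDerivAt.const_smul s)
    have h2 := ((hθd _ (hmem' s hs)).comp w h1).clm_apply π.hasFDerivAt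
    have h3 := (((hf.contDiffAt (hO.mem_nhds (hmem' s hs))).differentiableAt
      one_ne_zero).hasFDerivAt).comp w (hasFDerivAt_prodMk_left w s)
    have h4 := h3.unique h2
    rw [h4]
    simp [hπ, hsymm _ (hmem' s hs) v w]
    ring
  have hder : ∀ s ∈ uIcc (0 : ℝ) 1,
      HasDerivAt (fun s => s * θ (w - π w + s • π w) (π v))
        (s * fderiv ℝ θ (w - π w + s • π w) (π w) (π v) + θ (w - π w + s • π w) (π v)) s :=
    fun s hs => by
      have h1 : HasDerivAt (fun s => θ (w - π w + s • π w) (π v))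
          (fderiv ℝ θ (w - π w + s • π w) (π w) (π v)) s :=
        (ContinuousLinearMap.apply ℝ ℝ (π v)).hasFDerivAt.comp_hasDerivAt s
          ((hθd _ (hmem' s hs)).comp_hasDerivAt s (hcur s))
      refine ((hasDerivAt_id s).mul h1).congr_deriv ?_
      simp [add_comm]
  have hcont : ContinuousOn (fun s : ℝ =>
      (fderiv ℝ (fun p : E × ℝ => θ (p.1 - π p.1 + p.2 • π p.1) (π p.1)) (w, s)).comp
        (.inl ℝ E ℝ)) (uIcc 0 1) :=
    ((hf.continuousOn_fderiv_of_isOpen hO le_rfl).comp (f := fun s : ℝ => (w, s))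
      (by fun_prop) hmem').clm_comp continuousOn_const
  have hQ : fderiv ℝ (leafIntegral π θ) w = _ := hd.fderiv
  rw [hQ, ContinuousLinearMap.intervalIntegral_apply hcont.intervalIntegrable,
    intervalIntegral.integral_congr hval, intervalIntegral.integral_eq_sub_of_hasDerivAt hder]
  · simp
  · refine ContinuousOn.intervalIntegrable ?_
    refine (hcont.clm_apply (continuousOn_const (c := π v))).congr fun s hs => (hval s hs).symm

/-- Leaf directions are covered by the leafwise formula. On `ker π`, which is a complement, the leaf
integral vanishes identically, so its derivative there is zero. -/
theorem fderiv_leafIntegral_zero (hB : IsOpen B) (hBc : Convex ℝ B) (hθ : ContDiffOn ℝ ∞ θ B)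
    (hπ : ∀ v, π (π v) = π v)
    (hsymm : ∀ w ∈ B, ∀ u v, fderiv ℝ θ w (π u) (π v) = fderiv ℝ θ w (π v) (π u))
    (h0 : (0 : E) ∈ B) (v : E) :
    fderiv ℝ (leafIntegral π θ) 0 v = θ 0 (π v) := by
  have h0' : (0 : E) - π 0 ∈ B := by simpa using h0
  have hd : HasFDerivAt (leafIntegral π θ) (fderiv ℝ (leafIntegral π θ) 0) (0 : E) :=
    (((contDiffOn_leafIntegral hB hBc hθ).contDiffAt
      ((isOpen_leafDomain hB).mem_nhds ⟨h0, h0'⟩)).differentiableAt (by simp)).hasFDerivAt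
  have hker : fderiv ℝ (leafIntegral π θ) 0 (v - π v) = 0 := by
    have h1 : HasDerivAt (fun t : ℝ => t • (v - π v)) (v - π v) 0 := by
      simpa using! (hasDerivAt_id (0 : ℝ)).smul_const (v - π v)
    have h2 := hd.comp_hasDerivAt_of_eq (0 : ℝ) h1 (by simp)
    refine h2.unique ?_
    have : (leafIntegral π θ ∘ fun t : ℝ => t • (v - π v)) = fun _ => 0 := by
      ext t
      exact leafIntegral_of_apply_eq_zero (by simp [hπ])
    rw [this]
    exact hasDerivAt_const _ _
  rw [← fderiv_leafIntegral_apply hB hBc hθ hπ hsymm h0 h0' v, ← sub_eq_zero, ← map_sub, hker]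

end LeafIntegral

/-- A form taking constant values on two fields, and the value zero on their bracket, is closed on
them. -/
theorem fderiv_apply_apply_comm_of_lieBracket {E : Type*} [NormedAddCommGroup E] [NormedSpace ℝ E]
    {θ : E → E →L[ℝ] ℝ} {X Y : E → E} {w : E} (hθ : DifferentiableAt ℝ θ w)
    (hX : DifferentiableAt ℝ X w) (hY : DifferentiableAt ℝ Y w) {a b : ℝ}
    (hθX : ∀ᶠ x in 𝓝 w, θ x (X x) = a) (hθY : ∀ᶠ x in 𝓝 w, θ x (Y x) = b)
    (hXY : θ w (lieBracket ℝ X Y w) = 0) :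
    fderiv ℝ θ w (X w) (Y w) = fderiv ℝ θ w (Y w) (X w) := by
  -- Product rule for the locally constant function `θ(Z)`.
  have key : ∀ {Z : E → E} {c : ℝ}, DifferentiableAt ℝ Z w → (∀ᶠ x in 𝓝 w, θ x (Z x) = c) →
      ∀ v, θ w (fderiv ℝ Z w v) + fderiv ℝ θ w v (Z w) = 0 := fun {Z c} hZ hc v => by
    have h1 := hθ.hasFDerivAt.clm_apply hZ.hasFDerivAt
    have h2 := h1.unique ((hasFDerivAt_const c w).congr_of_eventuallyEq hc)
    simpa using congr($h2 v)
  have h1 := key hX hθX (Y w)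
  have h2 := key hY hθY (X w)
  simp only [lieBracket, map_sub] at hXY
  linarith

/-! ### The dual coframe and its closedness along the leaves. -/

section Coframe

variable {n : ℕ}

/-- The matrix whose columns are the vectors `Y j w`. -/
def frameMatrix (Y : Fin n → (Fin n → ℝ) → Fin n → ℝ) (w : Fin n → ℝ) : Matrix (Fin n) (Fin n) ℝ :=
  Matrix.of fun a b => Y b w a

/-- The coframe dual to the frame `Y`. -/
def coframe (Y : Fin n → (Fin n → ℝ) → Fin n → ℝ) (j : Fin n) (w : Fin n → ℝ) :
    (Fin n → ℝ) →L[ℝ] ℝ :=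
  ∑ m, (frameMatrix Y w)⁻¹ j m • ContinuousLinearMap.proj m

variable {Y : Fin n → (Fin n → ℝ) → Fin n → ℝ} {w : Fin n → ℝ} {B : Set (Fin n → ℝ)}

theorem coframe_apply (j : Fin n) (v : Fin n → ℝ) :
    coframe Y j w v = ((frameMatrix Y w)⁻¹).mulVec v j := by
  simp [coframe, Matrix.mulVec, dotProduct]

theorem coframe_apply_frame (hw : (frameMatrix Y w).det ≠ 0) (j l : Fin n) :
    coframe Y j w (Y l w) = if j = l then 1 else 0 := by
  have h : Y l w = (frameMatrix Y w).mulVec (Pi.single l 1) := by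
    ext a; simp [frameMatrix]
  rw [coframe_apply, h, Matrix.mulVec_mulVec, Matrix.nonsing_inv_mul _ (by simpa using hw)]
  simp [Matrix.one_apply]

theorem sum_coframe_smul_frame (hw : (frameMatrix Y w).det ≠ 0) (v : Fin n → ℝ) :
    ∑ l, coframe Y l w v • Y l w = v := by
  have h : (frameMatrix Y w).mulVec (((frameMatrix Y w)⁻¹).mulVec v) = v := by
    rw [Matrix.mulVec_mulVec, Matrix.mul_nonsing_inv _ (by simpa using hw), Matrix.one_mulVec]
  conv_rhs => rw [← h]
  ext a
  simp [coframe_apply, Matrix.mulVec, dotProduct, frameMatrix, mul_comm]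

theorem contDiffOn_matrix_det {E ι : Type*} [NormedAddCommGroup E] [NormedSpace ℝ E] [Fintype ι]
    [DecidableEq ι] {B : Set E} {A : E → Matrix ι ι ℝ}
    (h : ∀ i j, ContDiffOn ℝ ∞ (fun x => A x i j) B) : ContDiffOn ℝ ∞ (fun x => (A x).det) B := by
  simp only [Matrix.det_apply']
  exact .sum fun σ _ => contDiffOn_const.mul (contDiffOn_prod fun i _ => h _ _)

theorem contDiffOn_matrix_inv {E ι : Type*} [NormedAddCommGroup E] [NormedSpace ℝ E] [Fintype ι]
    [DecidableEq ι] {B : Set E} {A : E → Matrix ι ι ℝ}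
    (h : ∀ i j, ContDiffOn ℝ ∞ (fun x => A x i j) B) (hA : ∀ x ∈ B, (A x).det ≠ 0) (i j : ι) :
    ContDiffOn ℝ ∞ (fun x => (A x)⁻¹ i j) B := by
  have hadj : ContDiffOn ℝ ∞ (fun x => (A x).adjugate i j) B := by
    simp only [Matrix.adjugate_apply]
    refine contDiffOn_matrix_det fun a b => ?_
    by_cases ha : a = j
    · subst ha
      simpa using! contDiffOn_const
    · simpa [Matrix.updateRow_apply, ha] using h a b
  refine (((contDiffOn_matrix_det h).inv hA).mul hadj).congr fun x _ => ?_
  simp [Matrix.inv_def, Ring.inverse_eq_inv']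

theorem contDiffOn_coframe (hY : ∀ j, ContDiffOn ℝ ∞ (Y j) B)
    (hB : ∀ w ∈ B, (frameMatrix Y w).det ≠ 0) (j : Fin n) : ContDiffOn ℝ ∞ (coframe Y j) B := by
  refine .sum fun m _ => (contDiffOn_matrix_inv (fun a b => ?_) hB j m).smul contDiffOn_const
  exact contDiffOn_pi.1 (hY b) a

theorem IsElementary.coframe_apply_single {𝓕 : Set LocFun} (hBo : IsOpen B)
    (hY : ∀ j a, IsElementary 𝓕 B (fun w => Y j w a))
    (hB : ∀ w ∈ B, (frameMatrix Y w).det ≠ 0) (j m : Fin n) :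
    IsElementary 𝓕 B (fun w => coframe Y j w (Pi.single m 1)) :=
  (IsElementary.matrix_inv (A := frameMatrix Y) hBo (fun a b => hY b a) hB j m).congr
    fun w _ => by simp [coframe_apply]

/-- The projection onto the coordinates of level at least `i`. -/
def levelProj (lev : Fin n → ℕ) (i : ℕ) : (Fin n → ℝ) →L[ℝ] (Fin n → ℝ) :=
  .pi fun m => if i ≤ lev m then .proj m else 0

variable {lev : Fin n → ℕ} {i : ℕ}

theorem levelProj_apply (v : Fin n → ℝ) (m : Fin n) :
    levelProj lev i v m = if i ≤ lev m then v m else 0 := by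
  unfold levelProj
  split_ifs with h <;> simp [h]

theorem levelProj_levelProj (v : Fin n → ℝ) :
    levelProj lev i (levelProj lev i v) = levelProj lev i v := by
  ext m
  simp only [levelProj_apply]
  split_ifs <;> rfl

/-- If the components of level less than `i` of a frame are triangular, then the fields of level at
least `i` span the vectors without components of level less than `i`. -/
theorem coframe_levelProj_of_lt (hw : (frameMatrix Y w).det ≠ 0)
    (htri : ∀ m, lev m < i → ∀ j, lev m ≤ lev j → Y j w m = if j = m then 1 else 0)
    (v : Fin n → ℝ) {m : Fin n} (hm : lev m < i) : coframe Y m w (levelProj lev i v) = 0 := by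
  -- Compare the `m`-th components in the expansion of the projected vector in the frame. Terms of
  -- lower level vanish by induction. Among the others, triangularity leaves only the `m`-th, and
  -- the left side is zero.
  induction hl : lev m using Nat.strong_induction_on generalizing m with
  | h l ih =>
    have h := congr_fun (sum_coframe_smul_frame hw (levelProj lev i v)) m
    rw [levelProj_apply, if_neg (not_le.2 hm), Finset.sum_apply,
      Finset.sum_eq_single m] at h
    · simpa [htri m hm m le_rfl] using h
    · intro j _ hj
      by_cases hjm : lev m ≤ lev j
      · simp [htri m hm j hjm, hj]
      · simp [ih (lev j) (by omega) (by omega : lev j < i) rfl]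
    · simp

/-- The derivative of a form at a point is bilinear, so symmetry need only be tested on frame fields
of level at least `i`, which span the leaf directions. For these, brackets have components of level
greater than `i` only, and a form of level `i` kills them. -/
theorem fderiv_coframe_symm (hBo : IsOpen B) (hY : ∀ j, ContDiffOn ℝ ∞ (Y j) B)
    (hB : ∀ w ∈ B, (frameMatrix Y w).det ≠ 0)
    (htri : ∀ m, lev m < i → ∀ j, lev m ≤ lev j → ∀ w ∈ B, Y j w m = if j = m then 1 else 0)
    (hbr : ∀ j l, i ≤ lev j → i ≤ lev l → ∀ w ∈ B, ∃ c : Fin n → ℝ, (∀ m, lev m ≤ i → c m = 0) ∧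
      lieBracket ℝ (Y j) (Y l) w = ∑ m, c m • Y m w)
    {m : Fin n} (hm : lev m = i) (hw : w ∈ B) (u v : Fin n → ℝ) :
    fderiv ℝ (coframe Y m) w (levelProj lev i u) (levelProj lev i v) =
      fderiv ℝ (coframe Y m) w (levelProj lev i v) (levelProj lev i u) := by
  have hd : ∀ j, DifferentiableAt ℝ (Y j) w := fun j =>
    ((hY j).contDiffAt (hBo.mem_nhds hw)).differentiableAt (by simp)
  have hθ : DifferentiableAt ℝ (coframe Y m) w :=
    ((contDiffOn_coframe hY hB m).contDiffAt (hBo.mem_nhds hw)).differentiableAt (by simp)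
  have hcomm : ∀ j l, i ≤ lev j → i ≤ lev l →
      fderiv ℝ (coframe Y m) w (Y j w) (Y l w) = fderiv ℝ (coframe Y m) w (Y l w) (Y j w) := by
    intro j l hj hl
    have hc : ∀ j, ∀ᶠ x in 𝓝 w, coframe Y m x (Y j x) = if m = j then 1 else 0 := fun j => by
      filter_upwards [hBo.mem_nhds hw] with x hx using coframe_apply_frame (hB x hx) m j
    refine fderiv_apply_apply_comm_of_lieBracket hθ (hd j) (hd l) (hc j) (hc l) ?_
    obtain ⟨c, hc0, hc⟩ := hbr j l hj hl w hw
    rw [hc, map_sum]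
    simp [coframe_apply_frame (hB w hw), hc0 m hm.le]
  have hsum : ∀ v, levelProj lev i v =
      ∑ l, (if i ≤ lev l then coframe Y l w (levelProj lev i v) else 0) • Y l w := fun v => by
    conv_lhs => rw [← sum_coframe_smul_frame (hB w hw) (levelProj lev i v)]
    refine Finset.sum_congr rfl fun l _ => ?_
    split_ifs with h
    · rfl
    · rw [coframe_levelProj_of_lt (hB w hw) (fun m hm j hj => htri m hm j hj w hw) v (not_le.1 h)]
  rw [hsum u, hsum v]
  simp only [map_sum, map_smul, sum_apply, smul_apply,
    Finset.smul_sum]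
  rw [Finset.sum_comm]
  refine Finset.sum_congr rfl fun j _ => Finset.sum_congr rfl fun l _ => ?_
  split_ifs with h1 h2
  · rw [hcomm l j h1 h2, smul_comm]
  all_goals simp

end Coframe

/-! ### One quadrature for all the forms of a stage. -/

section Quadrature

variable {n : ℕ}

/-- The point with coordinates `(c, w, s)`. -/
def triple (c w : Fin n → ℝ) (s : ℝ) : Fin (n + n + 1) → ℝ :=
  Fin.snoc (α := fun _ => ℝ) (Fin.append c w) s

/-- The coefficients `c` of `(c, w, s)`. -/
def coeffPart (z : Fin (n + n + 1) → ℝ) : Fin n → ℝ := fun m => z (Fin.castAdd n m).castSucc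

/-- The point `w` of `(c, w, s)`. -/
def pointPart (z : Fin (n + n + 1) → ℝ) : Fin n → ℝ := fun m => z (Fin.natAdd n m).castSucc

@[simp] theorem coeffPart_triple (c w : Fin n → ℝ) (s : ℝ) : coeffPart (triple c w s) = c := by
  ext m
  simp only [coeffPart, triple, Fin.snoc_castSucc, Fin.append_left]

@[simp] theorem pointPart_triple (c w : Fin n → ℝ) (s : ℝ) : pointPart (triple c w s) = w := by
  ext m
  simp only [pointPart, triple, Fin.snoc_castSucc, Fin.append_right]

@[simp] theorem triple_last (c w : Fin n → ℝ) (s : ℝ) : triple c w s (Fin.last _) = s := by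
  simp only [triple, Fin.snoc_last]

@[simp] theorem coeffPart_update_last (z : Fin (n + n + 1) → ℝ) (s : ℝ) :
    coeffPart (Function.update z (Fin.last _) s) = coeffPart z := by
  ext m
  simp only [coeffPart, ne_eq, Fin.castSucc_ne_last, not_false_eq_true, Function.update_of_ne]

@[simp] theorem pointPart_update_last (z : Fin (n + n + 1) → ℝ) (s : ℝ) :
    pointPart (Function.update z (Fin.last _) s) = pointPart z := by
  ext m
  simp only [pointPart, ne_eq, Fin.castSucc_ne_last, not_false_eq_true, Function.update_of_ne]

theorem continuous_pointPart : Continuous (pointPart (n := n)) := by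
  unfold pointPart
  fun_prop

theorem IsElementary.triple {𝓕 : Set LocFun} {m : ℕ} {V : Set (Fin m → ℝ)}
    {c w : (Fin m → ℝ) → Fin n → ℝ} {s : (Fin m → ℝ) → ℝ}
    (hc : ∀ a, IsElementary 𝓕 V (fun x => c x a)) (hw : ∀ a, IsElementary 𝓕 V (fun x => w x a))
    (hs : IsElementary 𝓕 V s) (a : Fin (n + n + 1)) :
    IsElementary 𝓕 V (fun x => triple (c x) (w x) (s x) a) := by
  refine Fin.lastCases ?_ (fun a => ?_) a
  · simpa only [triple_last] using hs
  · refine Fin.addCases (fun a => ?_) (fun a => ?_) a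
    · simpa only [_root_.triple, Fin.snoc_castSucc, Fin.append_left] using hc a
    · simpa only [_root_.triple, Fin.snoc_castSucc, Fin.append_right] using hw a

/-- The value at `(c, w, s)` of the linear combination with coefficients `c` of the integrands of
the leaf integrals of the forms `θ j`. -/
def leafIntegrand (π : (Fin n → ℝ) →L[ℝ] (Fin n → ℝ))
    (θ : Fin n → (Fin n → ℝ) → (Fin n → ℝ) →L[ℝ] ℝ) (z : Fin (n + n + 1) → ℝ) : ℝ :=
  ∑ j, coeffPart z j *
    θ j (pointPart z - π (pointPart z) + z (Fin.last _) • π (pointPart z)) (π (pointPart z))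

/-- The domain of the integrand `leafIntegrand`. -/
def leafIntegrandDomain (π : (Fin n → ℝ) →L[ℝ] (Fin n → ℝ)) (B : Set (Fin n → ℝ)) :
    Set (Fin (n + n + 1) → ℝ) :=
  {z | pointPart z - π (pointPart z) ∈ B ∧
    pointPart z - π (pointPart z) + z (Fin.last _) • π (pointPart z) ∈ B}

/-- The quadrature from which the leaf integrals of all the forms `θ j` are obtained. -/
def leafQuadrature (π : (Fin n → ℝ) →L[ℝ] (Fin n → ℝ))
    (θ : Fin n → (Fin n → ℝ) → (Fin n → ℝ) →L[ℝ] ℝ) (B : Set (Fin n → ℝ)) : LocFun where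
  arity := n + n + 1
  dom := leafIntegrandDomain π B
  fn z := ∫ s in (0 : ℝ)..(z (Fin.last _)), leafIntegrand π θ (Function.update z (Fin.last _) s)

variable {π : (Fin n → ℝ) →L[ℝ] (Fin n → ℝ)} {B : Set (Fin n → ℝ)}
  {θ : Fin n → (Fin n → ℝ) → (Fin n → ℝ) →L[ℝ] ℝ} {𝓕 : Set LocFun}

theorem isOpen_leafIntegrandDomain (hB : IsOpen B) : IsOpen (leafIntegrandDomain π B) := by
  have := continuous_pointPart (n := n)
  exact (hB.preimage (by fun_prop)).inter (hB.preimage (by fun_prop))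

theorem IsElementary.clm_apply {m p : ℕ} {V : Set (Fin m → ℝ)} (hV : IsOpen V)
    {u : (Fin m → ℝ) → Fin p → ℝ}
    (hu : ∀ i, IsElementary 𝓕 V (fun x => u x i)) (T : (Fin p → ℝ) →L[ℝ] ℝ) :
    IsElementary 𝓕 V (fun x => T (u x)) := by
  refine (IsElementary.sum hV Finset.univ fun i _ =>
    (hu i).mul (.const (T (Pi.single i 1)) hV)).congr fun x _ => ?_
  conv_rhs => rw [pi_eq_sum_univ' (u x)]
  simp [map_sum]

theorem IsElementary.leafIntegrand (hB : IsOpen B)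
    (hθ : ∀ j m, IsElementary 𝓕 B (fun w => θ j w (Pi.single m 1))) :
    IsElementary 𝓕 (leafIntegrandDomain π B) (leafIntegrand π θ) := by
  have hD := isOpen_leafIntegrandDomain (π := π) hB
  have hw : ∀ m, IsElementary 𝓕 (leafIntegrandDomain π B) (fun z => pointPart z m) :=
    fun m => .coord _ hD
  have hπ : ∀ a, IsElementary 𝓕 (leafIntegrandDomain π B) (fun z => π (pointPart z) a) := fun a =>
    .clm_apply hD hw ((ContinuousLinearMap.proj a).comp π)
  have hp : ∀ a, IsElementary 𝓕 (leafIntegrandDomain π B) (fun z =>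
      (pointPart z - π (pointPart z) + z (Fin.last _) • π (pointPart z)) a) := fun a =>
    ((hw a).sub (hπ a)).add (.mul (.coord _ hD) (hπ a))
  refine .sum hD _ fun j _ => .mul (.coord _ hD) ?_
  refine (IsElementary.sum hD Finset.univ fun a _ =>
    (hπ a).mul (.comp hD (hθ j a) hp fun z hz => hz.2)).congr fun z _ => ?_
  have h := congrArg (θ j (pointPart z - π (pointPart z) + z (Fin.last _) • π (pointPart z)))
    (pi_eq_sum_univ' (π (pointPart z)))
  simp only [map_sum, map_smul, smul_eq_mul] at h
  exact h.symm

theorem isQuadrature_leafQuadrature (hB : IsOpen B) (hBc : Convex ℝ B) :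
    IsQuadrature (Fin.last (n + n)) (leafIntegrandDomain π B) (leafIntegrand π θ)
      (leafQuadrature π θ B).dom (leafQuadrature π θ B).fn := by
  refine ⟨isOpen_leafIntegrandDomain hB, 0, fun z hz => ⟨fun s hs => ?_, rfl⟩⟩
  obtain ⟨h1, h2⟩ := hz
  rw [leafIntegrandDomain, mem_ofPred_eq, pointPart_update_last, Function.update_self]
  refine ⟨h1, ?_⟩
  -- The domain constrains only the two ends of the path of integration. The points between them are
  -- in `B` by convexity.
  rw [← segment_eq_uIcc] at hs
  obtain ⟨a, b, ha, hb, hab, rfl⟩ := hs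
  have := hBc h1 h2 ha hb hab
  convert this using 1
  rw [smul_add b, ← add_assoc, ← add_smul, hab, one_smul, smul_smul]
  simp

/-- Substituting the unit vector `e_j` for the coefficients and `1` for the upper limit extracts the
individual primitive from the common quadrature. -/
theorem IsElementary.leafIntegral {U : Set (Fin n → ℝ)} (hB : IsOpen B) (hU : IsOpen U)
    (hUB : ∀ w ∈ U, w ∈ B ∧ w - π w ∈ B) (h𝓕 : leafQuadrature π θ B ∈ 𝓕) (j : Fin n) :
    IsElementary 𝓕 U (leafIntegral π (θ j)) := by
  have hF : IsElementary 𝓕 (leafIntegrandDomain π B) (leafQuadrature π θ B).fn :=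
    .base h𝓕 (isOpen_leafIntegrandDomain hB)
  refine (IsElementary.comp hU hF (IsElementary.triple (c := fun _ => Pi.single j 1)
    (w := fun w => w) (s := fun _ => 1) (fun a => .const _ hU) (fun a => .coord a hU)
    (.const _ hU)) ?_).congr ?_
  · intro w hw
    obtain ⟨h1, h2⟩ := hUB w hw
    change _root_.triple (Pi.single j 1) w 1 ∈ _
    simpa [leafIntegrandDomain] using And.intro h2 h1
  · intro w hw
    change (leafQuadrature π θ B).fn (_root_.triple (Pi.single j 1) w 1) = _
    simp [leafQuadrature, _root_.leafIntegrand, _root_.leafIntegral, Pi.single_apply]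

end Quadrature

/-! ### The inverse function theorem for smooth maps. -/

section LocalDiffeomorph

variable {E F : Type*} [NormedAddCommGroup E] [NormedSpace ℝ E] [NormedAddCommGroup F]
  [NormedSpace ℝ F]

theorem ContinuousLinearMap.isInvertible_of_injective [FiniteDimensional ℝ E] {f : E →L[ℝ] E}
    (hf : Function.Injective f) : f.IsInvertible :=
  ⟨(LinearEquiv.ofInjectiveEndo (f : E →ₗ[ℝ] E) hf).toContinuousLinearEquiv, by ext x; rfl⟩

theorem exists_openPartialHomeomorph_of_contDiffOn [CompleteSpace E] {f : E → F} {U : Set E} {a : E}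
    (hU : IsOpen U) (ha : a ∈ U) (hf : ContDiffOn ℝ ∞ f U) (hf' : (fderiv ℝ f a).IsInvertible) :
    ∃ e : OpenPartialHomeomorph E F, a ∈ e.source ∧ e.source ⊆ U ∧ ⇑e = f ∧
      ContDiffOn ℝ ∞ e.symm e.target := by
  obtain ⟨f', hff'⟩ := hf'
  have hfa : ContDiffAt ℝ ∞ f a := hf.contDiffAt (hU.mem_nhds ha)
  have hd : HasFDerivAt f (f' : E →L[ℝ] F) a := by
    rw [hff']
    exact (hfa.differentiableAt (by simp)).hasFDerivAt
  let e := hfa.toOpenPartialHomeomorph f hd (by simp)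
  -- Shrinking to the open set of points with invertible differential makes the inverse smooth on
  -- the entire target.
  let S := U ∩ fderiv ℝ f ⁻¹' range ((↑) : (E ≃L[ℝ] F) → E →L[ℝ] F)
  have hS : IsOpen S := (hf.continuousOn_fderiv_of_isOpen hU (by simp)).isOpen_inter_preimage hU
    ContinuousLinearEquiv.isOpen
  refine ⟨e.restrOpen S hS, ⟨hfa.mem_toOpenPartialHomeomorph_source hd (by simp), ha, f', hff'⟩,
    fun x hx => hx.2.1, rfl, fun y hy => ?_⟩
  have hx := (e.restrOpen S hS).map_target hy
  obtain ⟨f₁, hf₁⟩ := hx.2.2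
  have hfx : ContDiffAt ℝ ∞ f ((e.restrOpen S hS).symm y) := hf.contDiffAt (hU.mem_nhds hx.2.1)
  refine ((e.restrOpen S hS).contDiffAt_symm (f₀' := f₁) hy ?_ hfx).contDiffWithinAt
  rw [hf₁]
  exact (hfx.differentiableAt (by simp)).hasFDerivAt

namespace OpenPartialHomeomorph

variable {g : OpenPartialHomeomorph E F}

theorem hasFDerivAt_of_contDiffOn (hg : ContDiffOn ℝ ∞ g g.source) {y : E} (hy : y ∈ g.source) :
    HasFDerivAt g (fderiv ℝ g y) y :=
  ((hg.contDiffAt (g.open_source.mem_nhds hy)).differentiableAt (by simp)).hasFDerivAt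

theorem fderiv_symm_comp_fderiv (hg : ContDiffOn ℝ ∞ g g.source)
    (hg' : ContDiffOn ℝ ∞ g.symm g.target) {y : E} (hy : y ∈ g.source) :
    (fderiv ℝ g.symm (g y)).comp (fderiv ℝ g y) = .id ℝ E := by
  have h1 := (hasFDerivAt_of_contDiffOn (g := g.symm) hg' (g.map_source hy)).comp y
    (hasFDerivAt_of_contDiffOn hg hy)
  refine h1.unique ((hasFDerivAt_id y).congr_of_eventuallyEq ?_)
  filter_upwards [g.open_source.mem_nhds hy] with x hx using g.left_inv hx

theorem fderiv_comp_fderiv_symm (hg : ContDiffOn ℝ ∞ g g.source)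
    (hg' : ContDiffOn ℝ ∞ g.symm g.target) {y : E} (hy : y ∈ g.source) :
    (fderiv ℝ g y).comp (fderiv ℝ g.symm (g y)) = .id ℝ F := by
  have := fderiv_symm_comp_fderiv (g := g.symm) hg' hg (g.map_source hy)
  rwa [symm_symm, g.left_inv hy] at this

theorem isInvertible_fderiv (hg : ContDiffOn ℝ ∞ g g.source)
    (hg' : ContDiffOn ℝ ∞ g.symm g.target) {y : E} (hy : y ∈ g.source) :
    (fderiv ℝ g y).IsInvertible :=
  .of_inverse (fderiv_comp_fderiv_symm hg hg' hy) (fderiv_symm_comp_fderiv hg hg' hy)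

theorem inverse_fderiv_symm (hg : ContDiffOn ℝ ∞ g g.source)
    (hg' : ContDiffOn ℝ ∞ g.symm g.target) {y : E} (hy : y ∈ g.source) :
    (fderiv ℝ g.symm (g y)).inverse = fderiv ℝ g y :=
  ContinuousLinearMap.inverse_eq (fderiv_symm_comp_fderiv hg hg' hy)
    (fderiv_comp_fderiv_symm hg hg' hy)

end OpenPartialHomeomorph

end LocalDiffeomorph

/-! ### Straightening the leaves stage by stage. -/

section StagedChart

variable {n : ℕ}

/-- A diffeomorphism `g` whose components of level less than `i` are adapted to the frame `A` and
are obtained from the data `𝓑` by quadratures. -/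
structure IsStagedChart (𝓑 : Set LocFun) (A : Fin n → (Fin n → ℝ) → Fin n → ℝ) (lev : Fin n → ℕ)
    (D : Set (Fin n → ℝ)) (y₀ : Fin n → ℝ) (i : ℕ) (F : ℕ → LocFun)
    (g : OpenPartialHomeomorph (Fin n → ℝ) (Fin n → ℝ)) : Prop where
  mem_source : y₀ ∈ g.source
  source_subset : g.source ⊆ D
  map_eq_zero : g y₀ = 0
  contDiffOn : ContDiffOn ℝ ∞ g g.source
  contDiffOn_symm : ContDiffOn ℝ ∞ g.symm g.target
  fderiv_frame : ∀ j, fderiv ℝ g y₀ (A j y₀) = Pi.single j 1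
  isElementary : ∀ m, IsElementary (available 𝓑 F (min (lev m + 1) i)) g.source (fun y => g y m)
  fderiv_apply : ∀ m, lev m < i → ∀ j, lev m ≤ lev j → ∀ y ∈ g.source,
    fderiv ℝ g y (A j y) m = if j = m then 1 else 0

/-- The push-forward of a vector field by `g`. -/
def pushField (g : OpenPartialHomeomorph (Fin n → ℝ) (Fin n → ℝ))
    (X : (Fin n → ℝ) → Fin n → ℝ) (w : Fin n → ℝ) : Fin n → ℝ :=
  fderiv ℝ g (g.symm w) (X (g.symm w))

variable {𝓑 : Set LocFun} {A : Fin n → (Fin n → ℝ) → Fin n → ℝ} {lev : Fin n → ℕ}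
  {D : Set (Fin n → ℝ)} {y₀ : Fin n → ℝ} {i : ℕ} {F : ℕ → LocFun}
  {g : OpenPartialHomeomorph (Fin n → ℝ) (Fin n → ℝ)}

/-- An affine map suffices: the coframe at `y₀`, applied to `y - y₀`, sends the frame at `y₀` to the
standard basis and needs no quadrature. -/
theorem exists_isStagedChart_zero (hD : IsOpen D) (hy₀ : y₀ ∈ D)
    (hdet : (frameMatrix A y₀).det ≠ 0) (F : ℕ → LocFun) :
    ∃ g, IsStagedChart 𝓑 A lev D y₀ 0 F g := by
  let T : (Fin n → ℝ) →L[ℝ] (Fin n → ℝ) := .pi fun m => coframe A m y₀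
  have hT : Function.Injective T := by
    rw [injective_iff_map_eq_zero]
    intro v hv
    rw [← sum_coframe_smul_frame hdet v]
    exact Finset.sum_eq_zero fun l _ => by simp [show coframe A l y₀ v = 0 from congr_fun hv l]
  have hd : ∀ y, HasFDerivAt (fun y => T (y - y₀)) T y := fun y => by
    simpa using! T.hasFDerivAt.comp y ((hasFDerivAt_id y).sub_const y₀)
  have hsm : ContDiff ℝ ∞ fun y => T (y - y₀) := by fun_prop
  obtain ⟨g, hg₀, hgD, hgT, hg⟩ := exists_openPartialHomeomorph_of_contDiffOn hD hy₀
    hsm.contDiffOn (by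
      rw [(hd y₀).fderiv]
      exact ContinuousLinearMap.isInvertible_of_injective hT)
  refine ⟨g, hg₀, hgD, by simp [hgT], by rw [hgT]; exact hsm.contDiffOn, hg, fun j => ?_,
    fun m => ?_, by simp⟩
  · rw [hgT, (hd y₀).fderiv]
    ext m
    simp [T, coframe_apply_frame hdet, Pi.single_apply, eq_comm]
  · rw [hgT]
    exact .clm_apply (u := fun y => y - y₀) g.open_source
      (fun i => (IsElementary.coord i g.open_source).sub (.const _ g.open_source))
      (coframe A m y₀)

namespace IsStagedChart

variable (h : IsStagedChart 𝓑 A lev D y₀ i F g)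
include h

theorem contDiffOn_pushField {X : (Fin n → ℝ) → Fin n → ℝ} (hX : ContDiffOn ℝ ∞ X D) :
    ContDiffOn ℝ ∞ (pushField g X) g.target := by
  have h1 : ContDiffOn ℝ ∞ (fun y => fderiv ℝ g y (X y)) g.source :=
    (h.contDiffOn.fderiv_of_isOpen g.open_source (by simp)).clm_apply (hX.mono h.source_subset)
  exact h1.comp h.contDiffOn_symm g.mapsTo_symm

theorem pushField_eq_pullback {X : (Fin n → ℝ) → Fin n → ℝ} {w : Fin n → ℝ} (hw : w ∈ g.target) :
    pushField g X w = pullback ℝ g.symm X w := by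
  have := OpenPartialHomeomorph.inverse_fderiv_symm h.contDiffOn h.contDiffOn_symm
    (g.map_target hw)
  rw [g.right_inv hw] at this
  rw [pullback, this, pushField]

theorem det_pushField_ne_zero (hdet : ∀ y ∈ D, (frameMatrix A y).det ≠ 0) {w : Fin n → ℝ}
    (hw : w ∈ g.target) : (frameMatrix (fun j => pushField g (A j)) w).det ≠ 0 := by
  have hy := g.map_target hw
  intro h0
  obtain ⟨v, hv, hv0⟩ := Matrix.exists_mulVec_eq_zero_iff.2 h0
  refine hdet _ (h.source_subset hy) (Matrix.exists_mulVec_eq_zero_iff.1 ⟨v, hv, ?_⟩)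
  obtain ⟨e, he⟩ := OpenPartialHomeomorph.isInvertible_fderiv h.contDiffOn h.contDiffOn_symm hy
  have h1 : ∀ (Y : Fin n → (Fin n → ℝ) → Fin n → ℝ) (x : Fin n → ℝ),
      (frameMatrix Y x).mulVec v = ∑ j, v j • Y j x := fun Y x => by
    ext a
    simp [frameMatrix, Matrix.mulVec, dotProduct, mul_comm]
  rw [h1] at hv0 ⊢
  apply e.injective
  rw [map_zero, ← hv0, map_sum]
  refine Finset.sum_congr rfl fun j _ => ?_
  rw [map_smul, pushField, ← he]
  rfl

theorem lieBracket_pushField (hD : IsOpen D) (hA : ∀ j, ContDiffOn ℝ ∞ (A j) D)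
    {j l : Fin n} {c : Fin n → ℝ} {w : Fin n → ℝ} (hw : w ∈ g.target)
    (hc : lieBracket ℝ (A j) (A l) (g.symm w) = ∑ m, c m • A m (g.symm w)) :
    lieBracket ℝ (pushField g (A j)) (pushField g (A l)) w = ∑ m, c m • pushField g (A m) w := by
  have hev : ∀ j, pushField g (A j) =ᶠ[𝓝 w] pullback ℝ g.symm (A j) := fun j => by
    filter_upwards [g.open_target.mem_nhds hw] with x hx using h.pushField_eq_pullback hx
  have hd : ∀ j, DifferentiableAt ℝ (A j) (g.symm w) := fun j =>
    ((hA j).contDiffAt (hD.mem_nhds (h.source_subset (g.map_target hw)))).differentiableAt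
      (by simp)
  rw [(hev j).lieBracket_vectorField_eq (hev l), ← pullback_lieBracket (n := ∞)
      (by simp only [minSmoothness_of_isRCLikeNormedField]; norm_cast)
    (h.contDiffOn_symm.contDiffAt (g.open_target.mem_nhds hw)) (hd j) (hd l)]
  rw [← h.pushField_eq_pullback hw, pushField, hc, map_sum]
  simp [pushField]

theorem isElementary_pushField {X : (Fin n → ℝ) → Fin n → ℝ}
    (hX : ∀ a, IsElementary 𝓑 D (fun y => X y a)) (a : Fin n) :
    IsElementary (available 𝓑 F i) g.target (fun w => pushField g X w a) := by
  have hg : ∀ m, IsElementary (available 𝓑 F i) g.source (fun y => g y m) := fun m =>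
    (h.isElementary m).mono (available_mono (min_le_right _ _))
  have hs := fun m => IsElementary.inverse g hg (fun x hx =>
    OpenPartialHomeomorph.isInvertible_fderiv h.contDiffOn h.contDiffOn_symm hx) m
  have h1 : IsElementary (available 𝓑 F i) g.source (fun y => fderiv ℝ g y (X y) a) := by
    refine (IsElementary.fderiv_apply (hg a) (X := X) fun b =>
      ((hX b).mono subset_union_left).restrict g.open_source h.source_subset).congr fun y hy => ?_
    have := (hasFDerivAt_pi'.1
      (OpenPartialHomeomorph.hasFDerivAt_of_contDiffOn h.contDiffOn hy) a).fderiv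
    simp only [this]
    rfl
  exact .comp g.open_target h1 hs g.mapsTo_symm

theorem pushField_apply {m j : Fin n} (hm : lev m < i) (hj : lev m ≤ lev j) {w : Fin n → ℝ}
    (hw : w ∈ g.target) : pushField g (A j) w m = if j = m then 1 else 0 :=
  h.fderiv_apply m hm j hj _ (g.map_target hw)

/-- Fields of level at least `i` are tangent to the leaves on which the coordinates already found
are constant. -/
theorem levelProj_pushField {j : Fin n} (hj : i ≤ lev j) {w : Fin n → ℝ} (hw : w ∈ g.target) :
    levelProj lev i (pushField g (A j) w) = pushField g (A j) w := by
  ext m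
  rw [levelProj_apply]
  split_ifs with hm
  · rfl
  · rw [h.pushField_apply (by omega) (by omega) hw, if_neg]
    rintro rfl
    exact hm hj

theorem zero_mem_target : (0 : Fin n → ℝ) ∈ g.target := by
  simpa [h.map_eq_zero] using g.map_source h.mem_source

theorem pushField_zero (j : Fin n) : pushField g (A j) 0 = Pi.single j 1 := by
  have : g.symm 0 = y₀ := by rw [← h.map_eq_zero, g.left_inv h.mem_source]
  rw [pushField, this, h.fderiv_frame]

end IsStagedChart

/-- The map replacing the coordinates of level `i` by the leaf integrals of the forms `θ`. -/
def leafStep (lev : Fin n → ℕ) (i : ℕ) (θ : Fin n → (Fin n → ℝ) → (Fin n → ℝ) →L[ℝ] ℝ)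
    (w : Fin n → ℝ) (m : Fin n) : ℝ :=
  if lev m = i then leafIntegral (levelProj lev i) (θ m) w else w m

theorem IsQuadratureSequence.update (hF : IsQuadratureSequence 𝓑 i F) {f : LocFun}
    {E : Set (Fin f.arity → ℝ)} {h : (Fin f.arity → ℝ) → ℝ} {a : Fin f.arity}
    (hh : IsElementary (available 𝓑 F i) E h) (hf : IsQuadrature a E h f.dom f.fn) :
    IsQuadratureSequence 𝓑 (i + 1) (Function.update F i f) := by
  intro l hl
  rw [available_congr (G := F) fun j hj => Function.update_of_ne (by omega) _ _]
  rcases Nat.lt_succ_iff_lt_or_eq.1 hl with hl | rfl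
  · rw [Function.update_of_ne hl.ne]
    exact hF l hl
  · rw [Function.update_self]
    exact ⟨E, h, a, hh, hf⟩

theorem available_update_of_le {l : ℕ} (hl : l ≤ i) (f : LocFun) :
    available 𝓑 (Function.update F i f) l = available 𝓑 F l :=
  available_congr fun j hj => Function.update_of_ne (by omega) _ _

/-- The inductive step: the coordinates of level `i` are replaced by primitives of the corresponding
forms, at the cost of one quadrature. Coordinates of other levels are untouched. -/
theorem IsStagedChart.exists_succ (h : IsStagedChart 𝓑 A lev D y₀ i F g)
    (hF : IsQuadratureSequence 𝓑 i F) (hD : IsOpen D) (hA : ∀ j, ContDiffOn ℝ ∞ (A j) D)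
    (hAe : ∀ j a, IsElementary 𝓑 D (fun y => A j y a))
    (hdet : ∀ y ∈ D, (frameMatrix A y).det ≠ 0)
    (hbr : ∀ j l, i ≤ lev j → i ≤ lev l → ∀ y ∈ D, ∃ c : Fin n → ℝ, (∀ m, lev m ≤ i → c m = 0) ∧
      lieBracket ℝ (A j) (A l) y = ∑ m, c m • A m y) :
    ∃ (F' : ℕ → LocFun) (g' : OpenPartialHomeomorph (Fin n → ℝ) (Fin n → ℝ)),
      IsQuadratureSequence 𝓑 (i + 1) F' ∧ IsStagedChart 𝓑 A lev D y₀ (i + 1) F' g' := by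
  -- A ball is taken because the integration along segments needs a convex domain.
  obtain ⟨r, hr, hB⟩ := Metric.isOpen_iff.1 g.open_target 0 h.zero_mem_target
  set B := Metric.ball (0 : Fin n → ℝ) r
  have hBo : IsOpen B := Metric.isOpen_ball
  have hBc : Convex ℝ B := convex_ball 0 r
  have h0 : (0 : Fin n → ℝ) ∈ B := Metric.mem_ball_self hr
  set Y := fun j => pushField g (A j) with hYdef
  set θ := coframe Y with hθdef
  set π := levelProj lev i with hπdef
  have hπ : ∀ v, π (π v) = π v := levelProj_levelProj
  have hY : ∀ j, ContDiffOn ℝ ∞ (Y j) B := fun j => (h.contDiffOn_pushField (hA j)).mono hB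
  have hYdet : ∀ w ∈ B, (frameMatrix Y w).det ≠ 0 := fun w hw => h.det_pushField_ne_zero hdet (hB hw)
  have hYe : ∀ j a, IsElementary (available 𝓑 F i) B (fun w => Y j w a) := fun j a =>
    (h.isElementary_pushField (hAe j) a).restrict hBo hB
  have hθ : ∀ j, ContDiffOn ℝ ∞ (θ j) B := contDiffOn_coframe hY hYdet
  have hsymm : ∀ m, lev m = i → ∀ w ∈ B, ∀ u v,
      fderiv ℝ (θ m) w (π u) (π v) = fderiv ℝ (θ m) w (π v) (π u) := fun m hm w hw u v =>
    fderiv_coframe_symm hBo hY hYdet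
      (fun m hm j hj w hw => h.pushField_apply hm hj (hB hw))
      (fun j l hj hl w hw => by
        obtain ⟨c, hc0, hc⟩ := hbr j l hj hl _ (h.source_subset (g.map_target (hB hw)))
        exact ⟨c, hc0, h.lieBracket_pushField hD hA (hB hw) hc⟩) hm hw u v
  have hYπ : ∀ j, i ≤ lev j → ∀ w ∈ B, π (Y j w) = Y j w := fun j hj w hw =>
    h.levelProj_pushField hj (hB hw)
  set U := {w | w ∈ B ∧ w - π w ∈ B} with hU
  have hUo : IsOpen U := isOpen_leafDomain hBo
  have h0U : (0 : Fin n → ℝ) ∈ U := ⟨h0, by simpa using h0⟩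
  have hint : ∀ m, ContDiffOn ℝ ∞ (leafIntegral π (θ m)) U := fun m =>
    contDiffOn_leafIntegral hBo hBc (hθ m)
  have hstep : ContDiffOn ℝ ∞ (leafStep lev i θ) U := by
    refine contDiffOn_pi.2 fun m => ?_
    unfold leafStep
    split_ifs
    · exact hint m
    · exact (contDiff_apply ℝ ℝ m).contDiffOn
  have hstepd : ∀ w ∈ U, ∀ m v, fderiv ℝ (leafStep lev i θ) w v m =
      if lev m = i then fderiv ℝ (leafIntegral π (θ m)) w v else v m := fun w hw m v => by
    have h1 : HasFDerivAt (leafStep lev i θ) (fderiv ℝ (leafStep lev i θ) w) w :=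
      ((hstep.contDiffAt (hUo.mem_nhds hw)).differentiableAt (by simp)).hasFDerivAt
    have h2 := (hasFDerivAt_pi'.1 h1 m).fderiv
    have h3 : fderiv ℝ (leafStep lev i θ) w v m =
        fderiv ℝ (fun x => leafStep lev i θ x m) w v := by
      rw [h2]
      rfl
    rw [h3]
    unfold leafStep
    split_ifs with hm
    · rfl
    · rw [(hasFDerivAt_apply (𝕜 := ℝ) m w).fderiv]
      rfl
  -- At the origin the pushed frame is the standard basis, so `θ_m` is there the `m`-th coordinate
  -- form, and the primitive agrees to first order with the coordinate it replaces.
  have hstep0 : fderiv ℝ (leafStep lev i θ) 0 = .id ℝ _ := by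
    refine ContinuousLinearMap.ext fun v => funext fun m => ?_
    rw [hstepd 0 h0U]
    split_ifs with hm
    · rw [fderiv_leafIntegral_zero hBo hBc (hθ m) hπ (hsymm m hm) h0]
      have h1 := congr_fun (sum_coframe_smul_frame (hYdet 0 h0) (π v)) m
      simp only [hYdef, h.pushField_zero] at h1
      simp only [Finset.sum_apply, Pi.smul_apply, Pi.single_apply, smul_eq_mul, mul_ite, mul_one,
        mul_zero, Finset.sum_ite_eq, Finset.mem_univ, if_true] at h1
      rw [hθdef, hYdef, h1, hπdef, levelProj_apply, if_pos hm.ge]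
      rfl
    · rfl
  obtain ⟨e, he0, heU, hee, hes⟩ := exists_openPartialHomeomorph_of_contDiffOn hUo h0U hstep
    (by rw [hstep0]; exact ⟨.refl ℝ _, rfl⟩)
  have hec : ContDiffOn ℝ ∞ e e.source := by rw [hee]; exact hstep.mono heU
  refine ⟨Function.update F i (leafQuadrature π θ B), g.trans e,
    hF.update (IsElementary.leafIntegrand hBo fun j m =>
      IsElementary.coframe_apply_single hBo hYe hYdet j m) (isQuadrature_leafQuadrature hBo hBc), ?_⟩
  have hgs : (g.trans e).source ⊆ g.source := fun y hy => by
    rw [OpenPartialHomeomorph.trans_source] at hy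
    exact hy.1
  have hge : ∀ y ∈ (g.trans e).source, g y ∈ e.source := fun y hy => by
    rw [OpenPartialHomeomorph.trans_source] at hy
    exact hy.2
  have hmem : y₀ ∈ (g.trans e).source := by
    rw [OpenPartialHomeomorph.trans_source]
    exact ⟨h.mem_source, by simpa [h.map_eq_zero] using he0⟩
  have hfd : ∀ y ∈ (g.trans e).source, ∀ v,
      fderiv ℝ (g.trans e) y v = fderiv ℝ e (g y) (fderiv ℝ g y v) := fun y hy v => by
    have := ((OpenPartialHomeomorph.hasFDerivAt_of_contDiffOn hec (hge y hy)).comp y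
      (OpenPartialHomeomorph.hasFDerivAt_of_contDiffOn h.contDiffOn (hgs hy))).fderiv
    rw [OpenPartialHomeomorph.coe_trans, this]
    rfl
  refine ⟨hmem, hgs.trans h.source_subset, ?_, ?_, ?_, ?_, ?_, ?_⟩
  · rw [OpenPartialHomeomorph.coe_trans, Function.comp_apply, h.map_eq_zero, hee]
    ext m
    unfold leafStep
    split_ifs
    · exact leafIntegral_of_apply_eq_zero (map_zero _)
    · rfl
  · exact hec.comp (h.contDiffOn.mono hgs) hge
  · refine h.contDiffOn_symm.comp (hes.mono ?_) ?_
    · intro z hz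
      rw [OpenPartialHomeomorph.trans_target] at hz
      exact hz.1
    · intro z hz
      rw [OpenPartialHomeomorph.trans_target] at hz
      exact hz.2
  · intro j
    rw [hfd y₀ hmem, h.fderiv_frame, h.map_eq_zero, hee, hstep0]
    rfl
  · intro m
    -- A coordinate of level `l` is replaced once, by quadrature number `l` counted from `0`. It
    -- thus needs the first `l + 1` quadratures, and at an intermediate stage never more than those
    -- already made.
    have hgm : ∀ a, IsElementary (available 𝓑 (Function.update F i (leafQuadrature π θ B))
        (min (lev a + 1) (i + 1))) (g.trans e).source (fun y => g y a) := fun a => by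
      refine IsElementary.mono (available_mono (min_le_min_left _ (Nat.le_succ i))) ?_
      rw [available_update_of_le (min_le_right _ _)]
      exact (h.isElementary a).restrict (g.trans e).open_source hgs
    by_cases hm : lev m = i
    · have h1 : IsElementary (available 𝓑 (Function.update F i (leafQuadrature π θ B)) (i + 1))
          e.source (leafIntegral π (θ m)) :=
        .leafIntegral hBo e.open_source (fun w hw => heU hw)
          (Or.inr ⟨i, Nat.lt_succ_self i, Function.update_self ..⟩) m
      rw [hm, min_self]
      refine (IsElementary.comp (g.trans e).open_source h1 (fun a =>
        (hgm a).mono (available_mono (min_le_right _ _))) hge).congr fun y hy => ?_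
      simp only [OpenPartialHomeomorph.coe_trans, Function.comp_apply, hee, leafStep, hm, if_true]
      rfl
    · refine (hgm m).congr fun y hy => ?_
      simp [hee, leafStep, hm]
  · intro m hm j hj y hy
    have hw := hge y hy
    have hwU := heU hw
    have hyw : fderiv ℝ g y (A j y) = Y j (g y) := by
      simp only [hYdef, pushField, g.left_inv (hgs hy)]
    rw [hfd y hy, hee, hstepd _ hwU, hyw]
    -- At level `i` the leafwise derivative of the primitive is `θ_m`, evaluated on the dual frame.
    -- At lower levels the earlier triangularity persists.
    by_cases hmi : lev m = i
    · rw [if_pos hmi, ← hYπ j (hmi ▸ hj) _ hwU.1, fderiv_leafIntegral_apply hBo hBc (hθ m) hπ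
        (hsymm m hmi) hwU.1 hwU.2, hYπ j (hmi ▸ hj) _ hwU.1, hθdef,
        coframe_apply_frame (hYdet _ hwU.1)]
      simp only [eq_comm]
    · rw [if_neg hmi]
      exact h.pushField_apply (by omega) hj (hB hwU.1)

theorem exists_isStagedChart (hD : IsOpen D) (hy₀ : y₀ ∈ D) (hA : ∀ j, ContDiffOn ℝ ∞ (A j) D)
    (hAe : ∀ j a, IsElementary 𝓑 D (fun y => A j y a))
    (hdet : ∀ y ∈ D, (frameMatrix A y).det ≠ 0)
    (hbr : ∀ i j l, i ≤ lev j → i ≤ lev l → ∀ y ∈ D, ∃ c : Fin n → ℝ,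
      (∀ m, lev m ≤ i → c m = 0) ∧ lieBracket ℝ (A j) (A l) y = ∑ m, c m • A m y) (i : ℕ) :
    ∃ (F : ℕ → LocFun) (g : OpenPartialHomeomorph (Fin n → ℝ) (Fin n → ℝ)),
      IsQuadratureSequence 𝓑 i F ∧ IsStagedChart 𝓑 A lev D y₀ i F g := by
  induction i with
  | zero =>
    obtain ⟨g, hg⟩ := exists_isStagedChart_zero (𝓑 := 𝓑) (lev := lev) hD hy₀ (hdet y₀ hy₀)
      fun _ => ⟨0, ∅, 0⟩
    exact ⟨_, g, fun l hl => absurd hl (Nat.not_lt_zero l), hg⟩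
  | succ i ih =>
    obtain ⟨F, g, hF, hg⟩ := ih
    exact hg.exists_succ hF hD hA hAe hdet (hbr i)

end StagedChart

/-! ### Bases adapted to a flag of subspaces. -/

section AdaptedBasis

variable {V : Type*} [AddCommGroup V] [Module ℝ V]

/-- Induction from the small end of the flag: a basis adapted to the shifted flag is extended to a
basis of `S 0`. The new vectors get level `0`, and the old levels rise by one. -/
theorem exists_linearIndepOn_adapted {K : ℕ} {S : ℕ → Submodule ℝ V} (hS : Antitone S)
    (hK : S K = ⊥) : ∃ (s : Set V) (lev : V → ℕ), LinearIndepOn ℝ id s ∧ (∀ x ∈ s, lev x < K) ∧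
      ∀ i ≤ K, S i = Submodule.span ℝ {x ∈ s | i ≤ lev x} := by
  classical
  induction K generalizing S with
  | zero =>
    refine ⟨∅, fun _ => 0, linearIndepOn_empty ℝ id, by simp, fun i hi => ?_⟩
    obtain rfl : i = 0 := by omega
    simp [hK]
  | succ K ih =>
    obtain ⟨s, lev, hs, hlt, hspan⟩ := ih (S := fun i => S (i + 1))
      (fun i j hij => hS (by omega)) hK
    have hs1 : S 1 = Submodule.span ℝ s := by simpa using hspan 0 (Nat.zero_le _)
    have hs0 : s ⊆ S 0 := fun x hx => hS (Nat.zero_le 1) (hs1 ▸ Submodule.subset_span hx)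
    have hsub := hs.subset_extend hs0
    refine ⟨hs.extend hs0, fun x => if x ∈ s then lev x + 1 else 0, hs.linearIndepOn_extend hs0,
      fun x _ => ?_, fun i hi => ?_⟩
    · dsimp only
      split_ifs with hx
      · have := hlt x hx
        omega
      · omega
    · cases i with
      | zero =>
        simp only [Nat.zero_le, and_true, ofPred_mem_eq]
        exact le_antisymm (hs.subset_span_extend hs0)
          (Submodule.span_le.2 (hs.extend_subset hs0))
      | succ i =>
        rw [hspan i (by omega)]
        congr 1
        ext x
        simp only [mem_ofPred_eq]
        constructor
        · rintro ⟨hx, hi⟩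
          exact ⟨hsub hx, by simp [hx, hi]⟩
        · rintro ⟨-, hi⟩
          by_cases hx : x ∈ s
          · exact ⟨hx, by simpa [hx] using hi⟩
          · simp [hx] at hi

/-- A basis adapted to a flag, with the dual coordinates. -/
structure IsAdaptedBasis {n : ℕ} (S : ℕ → Submodule ℝ V) (k : ℕ) (b : Fin n → V)
    (c : Fin n → V →ₗ[ℝ] ℝ) (lev : Fin n → ℕ) : Prop where
  lev_le : ∀ j, lev j ≤ k
  coord_basis : ∀ m j, c m (b j) = if m = j then 1 else 0
  basis_mem : ∀ i ≤ k, ∀ j, i ≤ lev j → b j ∈ S i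
  coord_eq_zero : ∀ i ≤ k, ∀ X ∈ S i, ∀ j, lev j < i → c j X = 0
  sum_coord_smul : ∀ i ≤ k, ∀ X ∈ S i, ∑ j, c j X • b j = X

theorem exists_isAdaptedBasis {n k : ℕ} {S : ℕ → Submodule ℝ V}
    (hS : ∀ i < k, S (i + 1) ≤ S i) [FiniteDimensional ℝ (S 0)]
    (hn : Module.finrank ℝ (S 0) = n) : ∃ b c lev, IsAdaptedBasis (n := n) S k b c lev := by
  classical
  -- The flag is cut off to `⊥` after index `k`, so that everything left in `S k` receives level
  -- `k`.
  obtain ⟨s, lev, hs, hlt, hspan⟩ := exists_linearIndepOn_adapted (K := k + 1)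
    (S := fun i => if i ≤ k then S i else ⊥) (antitone_nat_of_succ_le fun i => by
      by_cases h : i + 1 ≤ k
      · simpa [h, (Nat.le_succ i).trans h] using hS i h
      · simp [h]) (by simp)
  have hspan' : ∀ i ≤ k, S i = Submodule.span ℝ {x ∈ s | i ≤ lev x} := fun i hi => by
    have := hspan i (by omega)
    simpa [hi] using this
  have hs0 : S 0 = Submodule.span ℝ s := by simpa using hspan' 0 (Nat.zero_le _)
  have hli : LinearIndependent ℝ ((↑) : s → V) := hs
  have : FiniteDimensional ℝ (Submodule.span ℝ s) := hs0 ▸ inferInstance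
  have hfin : Finite s := by
    have hb := Module.Basis.span hli
    rw [Subtype.range_coe] at hb
    exact Module.Finite.finite_basis hb
  have := Fintype.ofFinite s
  have hcard : Fintype.card s = n := by
    rw [← hn, hs0, finrank_span_set_eq_card hli, Set.toFinset_card]
  let e : Fin n ≃ s := (Fintype.equivFinOfCardEq hcard).symm
  let b : Fin n → V := fun j => e j
  have hb : LinearIndependent ℝ b := hli.comp e e.injective
  -- The coordinate forms are extended from the span to all of `V`. Their values outside it play no
  -- role.
  have hc : ∀ m, ∃ c : V →ₗ[ℝ] ℝ, ∀ j, c (b j) = if m = j then 1 else 0 := fun m => by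
    obtain ⟨c, hc⟩ := LinearMap.exists_extend ((Module.Basis.span hb).coord m)
    refine ⟨c, fun j => ?_⟩
    have h1 := LinearMap.congr_fun hc (Module.Basis.span hb j)
    have h2 : ((Module.Basis.span hb j : Submodule.span ℝ (range b)) : V) = b j :=
      congrArg Subtype.val (Module.Basis.span_apply hb j)
    simp only [LinearMap.comp_apply, Submodule.subtype_apply, h2] at h1
    rw [h1]
    simp [Finsupp.single_apply, eq_comm]
  choose c hc using hc
  have key : ∀ i ≤ k, ∀ X ∈ S i, (∀ j, lev (b j) < i → c j X = 0) ∧ ∑ j, c j X • b j = X := by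
    intro i hi X hX
    rw [hspan' i hi] at hX
    induction hX using Submodule.span_induction with
    | mem x hx =>
      obtain ⟨l, rfl⟩ : ∃ l, b l = x := ⟨e.symm ⟨x, hx.1⟩, by simp [b]⟩
      refine ⟨fun j hj => ?_, by simp [hc]⟩
      rw [hc, if_neg]
      rintro rfl
      exact absurd hx.2 (not_le.2 hj)
    | zero => simp
    | add x y _ _ hx hy =>
      refine ⟨fun j hj => by simp [hx.1 j hj, hy.1 j hj], ?_⟩
      simp only [map_add, add_smul, Finset.sum_add_distrib, hx.2, hy.2]
    | smul a x _ hx =>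
      refine ⟨fun j hj => by simp [hx.1 j hj], ?_⟩
      simp only [map_smul, smul_assoc, ← Finset.smul_sum, hx.2]
  refine ⟨b, c, fun j => lev (b j), fun j => Nat.lt_succ_iff.1 (hlt _ (e j).2), hc,
    fun i hi j hij => ?_, fun i hi X hX => (key i hi X hX).1, fun i hi X hX => (key i hi X hX).2⟩
  rw [hspan' i hi]
  exact Submodule.subset_span ⟨(e j).2, hij⟩

end AdaptedBasis

/-! ### The space `Ξ` in terms of an adapted basis. -/

section StageSum

variable {n d : ℕ} {M : Type*} [TopologicalSpace M] [ChartedSpace (Eu n) M]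
  {L : Submodule ℝ (VecField n M)} {Γ : VecField n M} {k : ℕ}
  {b : Fin d → VecField n M} {c : Fin d → VecField n M →ₗ[ℝ] ℝ} {lev : Fin d → ℕ}

namespace IsAdaptedBasis

variable (h : IsAdaptedBasis (lieSeq L Γ) k b c lev)
include h

/-- The `j`-th basis vector as an element of the space of its level. -/
def vec (j : Fin d) : lieSeq L Γ (lev j) := ⟨b j, h.basis_mem _ (h.lev_le j) j le_rfl⟩

/-- The values of `ξ ∈ Ξ` on the basis vectors. -/
def values : StageSum L Γ k →ₗ[ℝ] (Fin d → ℝ) where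
  toFun ξ j := (ξ ⟨lev j, Nat.lt_succ_iff.2 (h.lev_le j)⟩).1 (h.vec j)
  map_add' _ _ := rfl
  map_smul' _ _ := rfl

/-- Only basis vectors of level exactly `i` contribute. Those of lower level do not occur in `X`,
and those of higher level lie in `L_{i+1}`, which `ζ` annihilates. For `i = k` there are none of
higher level. -/
theorem apply_eq_sum {i : ℕ} (hi : i ≤ k) (ζ : stageDual L Γ k i) (X : lieSeq L Γ i) :
    ζ.1 X = ∑ j, if hj : lev j = i then
      ζ.1 ⟨b j, h.basis_mem i hi j hj.ge⟩ * c j X else 0 := by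
  classical
  have hX : X = ∑ j, if hj : i ≤ lev j then
      c j X.1 • (⟨b j, h.basis_mem i hi j hj⟩ : lieSeq L Γ i) else 0 := by
    apply Subtype.ext
    conv_lhs => rw [← h.sum_coord_smul i hi X.1 X.2]
    rw [AddSubmonoidClass.coe_finsetSum]
    refine Finset.sum_congr rfl fun j _ => ?_
    split_ifs with hj
    · rfl
    · simp [h.coord_eq_zero i hi X.1 X.2 j (not_le.1 hj)]
  conv_lhs => rw [hX]
  rw [map_sum]
  refine Finset.sum_congr rfl fun j _ => ?_
  by_cases hj : lev j = i
  · rw [dif_pos hj.ge, dif_pos hj, map_smul, smul_eq_mul, mul_comm]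
  · rw [dif_neg hj]
    split_ifs with hij
    · have hlt : i < lev j := lt_of_le_of_ne hij (Ne.symm hj)
      have hk := hlt.trans_le (h.lev_le j)
      rw [map_smul, ζ.2 hk _ (h.basis_mem (i + 1) hk j hlt), smul_zero]
    · exact map_zero _

/-- This gives `dim Ξ = n`: a form of stage `i` is determined by arbitrary values on the basis
vectors of level `i`, and each basis vector has exactly one level. -/
theorem values_bijective : Function.Bijective h.values := by
  constructor
  · rw [injective_iff_map_eq_zero]
    intro ξ hξ
    funext i
    apply Subtype.ext
    refine LinearMap.ext fun X => ?_
    rw [h.apply_eq_sum (Nat.lt_succ_iff.1 i.2)]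
    refine Finset.sum_eq_zero fun j _ => ?_
    split_ifs with hj
    · have hz : ∀ (i : ℕ) (hi : i < k + 1) (hj : lev j = i),
          (ξ ⟨i, hi⟩).1 ⟨b j, h.basis_mem i (Nat.lt_succ_iff.1 hi) j hj.ge⟩ = 0 := by
        rintro i hi rfl
        exact congr_fun hξ j
      rw [hz i i.2 hj, zero_mul]
    · rfl
  · intro v
    refine ⟨fun i => ⟨∑ j, (if lev j = i then v j else 0) • (c j).comp (lieSeq L Γ i).subtype,
      fun hi X hX => ?_⟩, ?_⟩
    · rw [LinearMap.sum_apply]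
      refine Finset.sum_eq_zero fun j _ => ?_
      split_ifs with hj
      · have := h.coord_eq_zero (i + 1) hi X.1 hX j (by omega)
        simp [this]
      · simp
    · funext j
      change (∑ a, (if lev a = lev j then v a else 0) •
        (c a).comp (lieSeq L Γ (lev j)).subtype) (h.vec j) = v j
      rw [LinearMap.sum_apply, Finset.sum_eq_single j]
      · simp [vec, h.coord_basis]
      · intro a _ ha
        rw [LinearMap.smul_apply, LinearMap.comp_apply, Submodule.subtype_apply]
        simp [vec, h.coord_basis, ha]
      · simp

/-- A combination of the functions `q j` of level `i`. -/
def stageQ (q : Fin d → M → ℝ) (i : Fin (k + 1)) : stageDual L Γ k i →ₗ[ℝ] (M → ℝ) where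
  toFun ζ := ∑ j, if hj : lev j = i then
      ζ.1 ⟨b j, h.basis_mem i (Nat.lt_succ_iff.1 i.2) j hj.ge⟩ • q j else 0
  map_add' ζ ζ' := by
    rw [← Finset.sum_add_distrib]
    refine Finset.sum_congr rfl fun j _ => ?_
    split_ifs
    · exact add_smul _ _ _
    · simp
  map_smul' a ζ := by
    rw [RingHom.id_apply, Finset.smul_sum]
    refine Finset.sum_congr rfl fun j _ => ?_
    split_ifs
    · exact mul_smul _ _ _
    · simp

theorem totalQ_stageQ (q : Fin d → M → ℝ) (ξ : StageSum L Γ k) (x : M) :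
    totalQ (h.stageQ q) ξ x = ∑ j, h.values ξ j * q j x := by
  simp only [totalQ, stageQ, LinearMap.coe_mk, AddHom.coe_mk, Finset.sum_apply]
  rw [Finset.sum_comm]
  refine Finset.sum_congr rfl fun j _ => ?_
  rw [Finset.sum_eq_single ⟨lev j, Nat.lt_succ_iff.2 (h.lev_le j)⟩]
  · simp [values, vec]
  · intro i _ hi
    rw [dif_neg fun hj => hi (Fin.ext hj.symm)]
    rfl
  · simp

theorem evalAt_eq_sum (hΓ : Γ ∈ L) (ξ : StageSum L Γ k) :
    evalAt hΓ ξ = ∑ j, h.values ξ j * c j Γ := by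
  simp only [evalAt]
  rw [Finset.sum_congr rfl fun i _ => h.apply_eq_sum (Nat.lt_succ_iff.1 i.2) (ξ i) _,
    Finset.sum_comm]
  refine Finset.sum_congr rfl fun j _ => ?_
  rw [Finset.sum_eq_single ⟨lev j, Nat.lt_succ_iff.2 (h.lev_le j)⟩]
  · simp [values, vec]
  · intro i _ hi
    rw [dif_neg fun hj => hi (Fin.ext hj.symm)]
  · simp

end IsAdaptedBasis

end StageSum

/-! ### Vector fields on `M` read in a chart with values in `Fin n → ℝ`. -/

section ChartTransfer

variable {n : ℕ} {M : Type*} [TopologicalSpace M]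

/-- The inverse of a chart, as a map from `Fin n → ℝ`. -/
def chartInv (φ : OpenPartialHomeomorph M (Eu n)) (y : Fin n → ℝ) : M := φ.symm (WithLp.toLp 2 y)

/-- A chart, as a map to `Fin n → ℝ`. -/
def chartFun (φ : OpenPartialHomeomorph M (Eu n)) (x : M) : Fin n → ℝ := WithLp.ofLp (φ x)

/-- The image of a chart, as a subset of `Fin n → ℝ`. -/
def chartDom (φ : OpenPartialHomeomorph M (Eu n)) : Set (Fin n → ℝ) :=
  {y | WithLp.toLp 2 y ∈ φ.target}

variable {φ : OpenPartialHomeomorph M (Eu n)}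

theorem isOpen_chartDom : IsOpen (chartDom φ) :=
  φ.open_target.preimage (PiLp.continuous_toLp 2 _)

theorem chartInv_mem_source {y : Fin n → ℝ} (hy : y ∈ chartDom φ) : chartInv φ y ∈ φ.source :=
  φ.map_target hy

theorem chartFun_mem_chartDom {x : M} (hx : x ∈ φ.source) : chartFun φ x ∈ chartDom φ :=
  φ.map_source hx

theorem chartFun_chartInv {y : Fin n → ℝ} (hy : y ∈ chartDom φ) : chartFun φ (chartInv φ y) = y := by
  rw [chartFun, chartInv, φ.right_inv hy]

theorem chartInv_chartFun {x : M} (hx : x ∈ φ.source) : chartInv φ (chartFun φ x) = x :=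
  φ.left_inv hx

theorem continuousOn_chartFun : ContinuousOn (chartFun φ) φ.source :=
  (PiLp.continuous_ofLp 2 _).comp_continuousOn φ.continuousOn

theorem isOpen_source_inter_chartFun_preimage {W : Set (Fin n → ℝ)} (hW : IsOpen W) :
    IsOpen (φ.source ∩ chartFun φ ⁻¹' W) :=
  continuousOn_chartFun.isOpen_inter_preimage φ.open_source hW

theorem setOf_chartInv_mem {W : Set (Fin n → ℝ)} (hW : W ⊆ chartDom φ) :
    {y : Fin n → ℝ | WithLp.toLp 2 y ∈ φ.target ∧
      φ.symm (WithLp.toLp 2 y) ∈ φ.source ∩ chartFun φ ⁻¹' W} = W := by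
  ext y
  constructor
  · rintro ⟨hy, -, hW⟩
    have := chartFun_chartInv (φ := φ) hy
    rw [← this]
    exact hW
  · intro hy
    have h1 := chartFun_chartInv (φ := φ) (hW hy)
    refine ⟨hW hy, chartInv_mem_source (hW hy), ?_⟩
    rw [mem_preimage]
    exact h1.symm ▸ hy

variable [ChartedSpace (Eu n) M]

/-- The components of a vector field in a chart. -/
def chartField (φ : OpenPartialHomeomorph M (Eu n)) (X : VecField n M) (y : Fin n → ℝ) :
    Fin n → ℝ :=
  fun j => along X (fun x => φ x j) (chartInv φ y)

variable (hφ : φ ∈ IsManifold.maximalAtlas 𝓘(ℝ, Eu n) ∞ M)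
include hφ

theorem contMDiffOn_chartFun : ContMDiffOn 𝓘(ℝ, Eu n) 𝓘(ℝ, Fin n → ℝ) ∞ (chartFun φ) φ.source :=
  (PiLp.contDiff_ofLp (p := 2)).contMDiff.comp_contMDiffOn (contMDiffOn_of_mem_maximalAtlas hφ)

theorem contMDiffOn_chartInv :
    ContMDiffOn 𝓘(ℝ, Fin n → ℝ) 𝓘(ℝ, Eu n) ∞ (chartInv φ) (chartDom φ) :=
  (contMDiffOn_symm_of_mem_maximalAtlas hφ).comp (PiLp.contDiff_toLp (p := 2)).contMDiff.contMDiffOn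
    fun _ hy => hy

theorem hasMFDerivAt_chartFun {x : M} (hx : x ∈ φ.source) :
    HasMFDerivAt 𝓘(ℝ, Eu n) 𝓘(ℝ, Fin n → ℝ) (chartFun φ) x
      (mfderiv 𝓘(ℝ, Eu n) 𝓘(ℝ, Fin n → ℝ) (chartFun φ) x) :=
  (((contMDiffOn_chartFun hφ).contMDiffAt (φ.open_source.mem_nhds hx)).mdifferentiableAt
    (by simp)).hasMFDerivAt

theorem hasMFDerivAt_chartInv {y : Fin n → ℝ} (hy : y ∈ chartDom φ) :
    HasMFDerivAt 𝓘(ℝ, Fin n → ℝ) 𝓘(ℝ, Eu n) (chartInv φ) y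
      (mfderiv 𝓘(ℝ, Fin n → ℝ) 𝓘(ℝ, Eu n) (chartInv φ) y) :=
  (((contMDiffOn_chartInv hφ).contMDiffAt (isOpen_chartDom.mem_nhds hy)).mdifferentiableAt
    (by simp)).hasMFDerivAt

theorem mfderiv_chartFun_comp_mfderiv_chartInv {y : Fin n → ℝ} (hy : y ∈ chartDom φ) :
    (mfderiv 𝓘(ℝ, Eu n) 𝓘(ℝ, Fin n → ℝ) (chartFun φ) (chartInv φ y)).comp
      (mfderiv 𝓘(ℝ, Fin n → ℝ) 𝓘(ℝ, Eu n) (chartInv φ) y) =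
        ContinuousLinearMap.id ℝ (TangentSpace 𝓘(ℝ, Fin n → ℝ) y) := by
  have h1 := (hasMFDerivAt_chartFun hφ (chartInv_mem_source hy)).comp y (hasMFDerivAt_chartInv hφ hy)
  refine hasMFDerivAt_unique h1 ((hasMFDerivAt_id y).congr_of_eventuallyEq ?_)
  filter_upwards [isOpen_chartDom.mem_nhds hy] with z hz using chartFun_chartInv hz

theorem mfderiv_chartInv_comp_mfderiv_chartFun {y : Fin n → ℝ} (hy : y ∈ chartDom φ) :
    (mfderiv 𝓘(ℝ, Fin n → ℝ) 𝓘(ℝ, Eu n) (chartInv φ) y).comp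
      (mfderiv 𝓘(ℝ, Eu n) 𝓘(ℝ, Fin n → ℝ) (chartFun φ) (chartInv φ y)) =
        ContinuousLinearMap.id ℝ (TangentSpace 𝓘(ℝ, Eu n) (chartInv φ y)) := by
  have h2 : HasMFDerivAt 𝓘(ℝ, Fin n → ℝ) 𝓘(ℝ, Eu n) (chartInv φ)
      (chartFun φ (chartInv φ y)) (mfderiv 𝓘(ℝ, Fin n → ℝ) 𝓘(ℝ, Eu n) (chartInv φ) y) := by
    rw [chartFun_chartInv hy]
    exact hasMFDerivAt_chartInv hφ hy
  have h1 := h2.comp _ (hasMFDerivAt_chartFun hφ (chartInv_mem_source hy))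
  refine hasMFDerivAt_unique h1 ((hasMFDerivAt_id _).congr_of_eventuallyEq ?_)
  filter_upwards [φ.open_source.mem_nhds (chartInv_mem_source hy)] with z hz
    using chartInv_chartFun hz

theorem chartField_eq_mfderiv (X : VecField n M) {y : Fin n → ℝ} (hy : y ∈ chartDom φ) :
    chartField φ X y =
      mfderiv 𝓘(ℝ, Eu n) 𝓘(ℝ, Fin n → ℝ) (chartFun φ) (chartInv φ y) (X (chartInv φ y)) := by
  funext j
  have h1 : HasMFDerivAt 𝓘(ℝ, Fin n → ℝ) 𝓘(ℝ, ℝ) (fun z : Fin n → ℝ => z j)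
      (chartFun φ (chartInv φ y)) (ContinuousLinearMap.proj (R := ℝ) (φ := fun _ => ℝ) j) :=
    (hasFDerivAt_apply (𝕜 := ℝ) j (chartFun φ (chartInv φ y))).hasMFDerivAt
  have h2 := h1.comp _ (hasMFDerivAt_chartFun hφ (chartInv_mem_source hy))
  have h3 : mfderiv 𝓘(ℝ, Eu n) 𝓘(ℝ, ℝ) (fun x => φ x j) (chartInv φ y) = _ := h2.mfderiv
  rw [chartField, along, h3]
  rfl

theorem chartField_eq_mpullback (X : VecField n M) {y : Fin n → ℝ} (hy : y ∈ chartDom φ) :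
    chartField φ X y = mpullback 𝓘(ℝ, Fin n → ℝ) 𝓘(ℝ, Eu n) (chartInv φ) X y := by
  rw [chartField_eq_mfderiv hφ X hy, mpullback_apply,
    ContinuousLinearMap.inverse_eq (mfderiv_chartInv_comp_mfderiv_chartFun hφ hy)
      (mfderiv_chartFun_comp_mfderiv_chartInv hφ hy)]
  rfl

theorem along_comp_chartFun (X : VecField n M) {f : (Fin n → ℝ) → ℝ} {x : M} (hx : x ∈ φ.source)
    (hf : DifferentiableAt ℝ f (chartFun φ x)) :
    along X (fun x => f (chartFun φ x)) x = fderiv ℝ f (chartFun φ x) (chartField φ X (chartFun φ x)) := by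
  have h2 := hf.hasFDerivAt.hasMFDerivAt.comp x (hasMFDerivAt_chartFun hφ hx)
  have h3 : mfderiv 𝓘(ℝ, Eu n) 𝓘(ℝ, ℝ) (fun x => f (chartFun φ x)) x = _ := h2.mfderiv
  rw [along, h3, chartField_eq_mfderiv hφ X (chartFun_mem_chartDom hx), chartInv_chartFun hx]
  rfl

theorem mfderiv_chartInv_chartField (X : VecField n M) {y : Fin n → ℝ} (hy : y ∈ chartDom φ) :
    mfderiv 𝓘(ℝ, Fin n → ℝ) 𝓘(ℝ, Eu n) (chartInv φ) y (chartField φ X y) = X (chartInv φ y) := by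
  rw [chartField_eq_mfderiv hφ X hy]
  exact congr($(mfderiv_chartInv_comp_mfderiv_chartFun hφ hy) (X (chartInv φ y)))

theorem chartField_smul (a : ℝ) (X : VecField n M) {y : Fin n → ℝ} (hy : y ∈ chartDom φ) :
    chartField φ (a • X) y = a • chartField φ X y := by
  rw [chartField_eq_mfderiv hφ _ hy, chartField_eq_mfderiv hφ _ hy]
  exact map_smul (mfderiv 𝓘(ℝ, Eu n) 𝓘(ℝ, Fin n → ℝ) (chartFun φ) (chartInv φ y)) a _

theorem chartField_sum {ι : Type*} (s : Finset ι) (X : ι → VecField n M) {y : Fin n → ℝ}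
    (hy : y ∈ chartDom φ) : chartField φ (∑ i ∈ s, X i) y = ∑ i ∈ s, chartField φ (X i) y := by
  rw [chartField_eq_mfderiv hφ _ hy, Finset.sum_apply]
  simp only [chartField_eq_mfderiv hφ _ hy]
  exact map_sum (mfderiv 𝓘(ℝ, Eu n) 𝓘(ℝ, Fin n → ℝ) (chartFun φ) (chartInv φ y)) _ _

variable {X Y : VecField n M}

theorem isInvertible_mfderiv_chartInv {y : Fin n → ℝ} (hy : y ∈ chartDom φ) :
    (mfderiv 𝓘(ℝ, Fin n → ℝ) 𝓘(ℝ, Eu n) (chartInv φ) y).IsInvertible :=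
  .of_inverse (mfderiv_chartInv_comp_mfderiv_chartFun hφ hy)
    (mfderiv_chartFun_comp_mfderiv_chartInv hφ hy)

variable [IsManifold 𝓘(ℝ, Eu n) ∞ M]

theorem contDiffOn_chartField (hX : ContMDiff 𝓘(ℝ, Eu n) 𝓘(ℝ, Eu n).tangent ∞
    (fun x => (⟨x, X x⟩ : TangentBundle 𝓘(ℝ, Eu n) M))) :
    ContDiffOn ℝ ∞ (chartField φ X) (chartDom φ) := by
  have : IsManifold 𝓘(ℝ, Eu n) 1 M := .of_le (n := ∞) (by norm_cast)
  intro y hy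
  have h1 := ContMDiffAt.mpullback_vectorField_preimage (hX (chartInv φ y))
    ((contMDiffOn_chartInv hφ).contMDiffAt (isOpen_chartDom.mem_nhds hy))
    (isInvertible_mfderiv_chartInv hφ hy) (by simp)
  have h2 := contMDiffAt_vectorSpace_iff_contDiffAt.1 h1
  refine (h2.congr_of_eventuallyEq ?_).contDiffWithinAt
  filter_upwards [isOpen_chartDom.mem_nhds hy] with z hz using chartField_eq_mpullback hφ X hz

theorem lieBracket_chartField (hX : ContMDiff 𝓘(ℝ, Eu n) 𝓘(ℝ, Eu n).tangent ∞
    (fun x => (⟨x, X x⟩ : TangentBundle 𝓘(ℝ, Eu n) M)))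
    (hY : ContMDiff 𝓘(ℝ, Eu n) 𝓘(ℝ, Eu n).tangent ∞
      (fun x => (⟨x, Y x⟩ : TangentBundle 𝓘(ℝ, Eu n) M))) {y : Fin n → ℝ} (hy : y ∈ chartDom φ) :
    lieBracket ℝ (chartField φ X) (chartField φ Y) y =
      chartField φ (mlieBracket 𝓘(ℝ, Eu n) X Y) y := by
  have : IsManifold 𝓘(ℝ, Eu n) (minSmoothness ℝ 2) M :=
    .of_le (n := ∞) (by simp only [minSmoothness_of_isRCLikeNormedField]; norm_cast)
  have h1 := mpullback_mlieBracket (n := ∞) ((hX (chartInv φ y)).mdifferentiableAt (by simp))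
    ((hY (chartInv φ y)).mdifferentiableAt (by simp))
    ((contMDiffOn_chartInv hφ).contMDiffAt (isOpen_chartDom.mem_nhds hy))
    (by simp only [minSmoothness_of_isRCLikeNormedField]; norm_cast)
  have h2 : ∀ V W : (Fin n → ℝ) → Fin n → ℝ,
      mlieBracket 𝓘(ℝ, Fin n → ℝ) (M := Fin n → ℝ) V W y = lieBracket ℝ V W y := fun V W =>
    (congrFun mlieBracketWithin_univ y).symm.trans
      ((congrFun mlieBracketWithin_eq_lieBracketWithin y).trans (congrFun lieBracketWithin_univ y))
  have hev : ∀ X, chartField φ X =ᶠ[𝓝 y] mpullback 𝓘(ℝ, Fin n → ℝ) 𝓘(ℝ, Eu n) (chartInv φ) X :=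
    fun X => by
      filter_upwards [isOpen_chartDom.mem_nhds hy] with z hz using chartField_eq_mpullback hφ X hz
  rw [chartField_eq_mpullback hφ _ hy]
  exact ((hev X).lieBracket_vectorField_eq (hev Y)).trans ((h2 _ _).symm.trans h1.symm)

end ChartTransfer

/-! ### The spaces `L_{Γ,i}` and the frame they give in a chart. -/

section LieSeq

variable {n : ℕ} {M : Type*} [TopologicalSpace M] [ChartedSpace (Eu n) M]
  {L : Submodule ℝ (VecField n M)} {Γ : VecField n M}

theorem mlieBracket_mem_lieSeq_succ {i : ℕ} {X Y : VecField n M} (hX : X ∈ lieSeq L Γ i)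
    (hY : Y ∈ lieSeq L Γ i) : mlieBracket 𝓘(ℝ, Eu n) X Y ∈ lieSeq L Γ (i + 1) :=
  Submodule.mem_sup_right (Submodule.subset_span ⟨X, hX, Y, hY, rfl⟩)

variable [IsManifold 𝓘(ℝ, Eu n) ∞ M] (hL : IsFrameLieAlgebra L)
include hL

theorem lieSeq_succ_le (hΓ : Γ ∈ L) (i : ℕ) : lieSeq L Γ (i + 1) ≤ lieSeq L Γ i := by
  induction i with
  | zero =>
    refine sup_le (by simpa using mem_lieSeq hΓ 0) (Submodule.span_le.2 ?_)
    rintro _ ⟨X, hX, Y, hY, rfl⟩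
    exact hL.lie_mem X hX Y hY
  | succ i ih =>
    refine sup_le (by simpa using mem_lieSeq hΓ (i + 1)) (Submodule.span_le.2 ?_)
    rintro _ ⟨X, hX, Y, hY, rfl⟩
    exact mlieBracket_mem_lieSeq_succ (ih hX) (ih hY)

theorem lieSeq_le (hΓ : Γ ∈ L) (i : ℕ) : lieSeq L Γ i ≤ L := by
  induction i with
  | zero => exact le_rfl
  | succ i ih => exact (lieSeq_succ_le hL hΓ i).trans ih

variable {k : ℕ} {b : Fin n → VecField n M} {c : Fin n → VecField n M →ₗ[ℝ] ℝ} {lev : Fin n → ℕ}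
  (h : IsAdaptedBasis (lieSeq L Γ) k b c lev)
  {φ : OpenPartialHomeomorph M (Eu n)} (hφ : φ ∈ IsManifold.maximalAtlas 𝓘(ℝ, Eu n) ∞ M)
include h hφ

theorem det_frameMatrix_chartField_ne_zero {y : Fin n → ℝ} (hy : y ∈ chartDom φ) :
    (frameMatrix (fun j => chartField φ (b j)) y).det ≠ 0 := by
  rw [← isUnit_iff_ne_zero, ← Matrix.isUnit_iff_isUnit_det, ← Matrix.mulVec_surjective_iff_isUnit]
  intro u
  obtain ⟨X, hX, hXu⟩ := hL.span_eq (chartInv φ y)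
    (mfderiv 𝓘(ℝ, Fin n → ℝ) 𝓘(ℝ, Eu n) (chartInv φ) y u)
  have h1 : chartField φ X y = u := by
    rw [chartField_eq_mfderiv hφ X hy, hXu]
    exact congr($(mfderiv_chartFun_comp_mfderiv_chartInv hφ hy) u)
  rw [← h.sum_coord_smul 0 (Nat.zero_le k) X hX, chartField_sum hφ _ _ hy] at h1
  refine ⟨fun j => c j X, ?_⟩
  rw [← h1]
  ext a
  simp [frameMatrix, Matrix.mulVec, dotProduct, chartField_smul hφ _ _ hy, mul_comm]

/-- For `i < k` the bracket lies in `L_{i+1}`, hence has no components of level at most `i`. For `i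
= k` it is zero, which is where commutativity of `L_k` enters. -/
theorem lieBracket_chartField_basis (hΓ : Γ ∈ L) (hk : IsAbelianSpace (lieSeq L Γ k)) (i : ℕ)
    (j l : Fin n) (hj : i ≤ lev j) (hl : i ≤ lev l) {y : Fin n → ℝ} (hy : y ∈ chartDom φ) :
    ∃ a : Fin n → ℝ, (∀ m, lev m ≤ i → a m = 0) ∧
      lieBracket ℝ (chartField φ (b j)) (chartField φ (b l)) y = ∑ m, a m • chartField φ (b m) y := by
  have hi := hj.trans (h.lev_le j)
  have hbj := h.basis_mem i hi j hj
  have hbl := h.basis_mem i hi l hl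
  rw [lieBracket_chartField hφ (hL.smooth _ (lieSeq_le hL hΓ i hbj))
    (hL.smooth _ (lieSeq_le hL hΓ i hbl)) hy]
  rcases hi.lt_or_eq with hik | rfl
  · have hZ := mlieBracket_mem_lieSeq_succ hbj hbl
    refine ⟨fun m => c m (mlieBracket 𝓘(ℝ, Eu n) (b j) (b l)), fun m hm =>
      h.coord_eq_zero (i + 1) hik _ hZ m (Nat.lt_succ_iff.2 hm), ?_⟩
    conv_lhs => rw [← h.sum_coord_smul (i + 1) hik _ hZ, chartField_sum hφ _ _ hy]
    exact Finset.sum_congr rfl fun m _ => chartField_smul hφ _ _ hy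
  · refine ⟨0, fun _ _ => rfl, ?_⟩
    rw [hk _ hbj _ hbl]
    have := chartField_smul hφ 0 (0 : VecField n M) hy
    simpa using this

theorem exists_isStagedChart_chartField (hΓ : Γ ∈ L) (hk : IsAbelianSpace (lieSeq L Γ k)) {x₀ : M}
    (hx₀ : x₀ ∈ φ.source) : ∃ (F : ℕ → LocFun) (g : OpenPartialHomeomorph (Fin n → ℝ) (Fin n → ℝ)),
      IsQuadratureSequence (fieldData L φ) (k + 1) F ∧
        IsStagedChart (fieldData L φ) (fun j => chartField φ (b j)) lev (chartDom φ)
          (chartFun φ x₀) (k + 1) F g := by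
  have hb : ∀ j, b j ∈ L := fun j => h.basis_mem 0 (Nat.zero_le k) j (Nat.zero_le _)
  exact exists_isStagedChart (A := fun j => chartField φ (b j)) isOpen_chartDom (chartFun_mem_chartDom hx₀)
    (fun j => contDiffOn_chartField hφ (hL.smooth _ (hb j)))
    (fun j a => .base (show LocFun.mk n (chartDom φ) (fun y => chartField φ (b j) y a) ∈
      fieldData L φ from ⟨b j, hb j, a, rfl⟩) isOpen_chartDom)
    (fun y hy => det_frameMatrix_chartField_ne_zero hL h hφ hy)
    (fun i j l hj hl y hy => lieBracket_chartField_basis hL h hφ hΓ hk i j l hj hl hy) _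

end LieSeq

/-! ### The functions `Q_ζ` on `M` and the coordinates they form. -/

section Assembly

variable {n : ℕ} {M : Type*} [TopologicalSpace M] [ChartedSpace (Eu n) M]
  {L : Submodule ℝ (VecField n M)} {Γ : VecField n M} {k : ℕ} {b : Fin n → VecField n M}
  {c : Fin n → VecField n M →ₗ[ℝ] ℝ} {lev : Fin n → ℕ} {φ : OpenPartialHomeomorph M (Eu n)}
  {y₀ : Fin n → ℝ} {F : ℕ → LocFun} {g : OpenPartialHomeomorph (Fin n → ℝ) (Fin n → ℝ)}

/-- The domain in `M` of the coordinates `g ∘ φ`. -/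
def pulledSource (φ : OpenPartialHomeomorph M (Eu n))
    (g : OpenPartialHomeomorph (Fin n → ℝ) (Fin n → ℝ)) : Set M :=
  φ.source ∩ chartFun φ ⁻¹' g.source

/-- The `j`-th of the coordinates `g ∘ φ`. -/
def pulledCoord (φ : OpenPartialHomeomorph M (Eu n))
    (g : OpenPartialHomeomorph (Fin n → ℝ) (Fin n → ℝ)) (j : Fin n) (x : M) : ℝ :=
  g (chartFun φ x) j

theorem IsAdaptedBasis.stageQ_apply (h : IsAdaptedBasis (lieSeq L Γ) k b c lev)
    (q : Fin n → M → ℝ) (i : Fin (k + 1)) (ζ : stageDual L Γ k i) (x : M) :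
    h.stageQ q i ζ x = ∑ j, (if hj : lev j = i then
      ζ.1 ⟨b j, h.basis_mem i (Nat.lt_succ_iff.1 i.2) j hj.ge⟩ else 0) * q j x := by
  simp only [stageQ, LinearMap.coe_mk, AddHom.coe_mk, Finset.sum_apply]
  refine Finset.sum_congr rfl fun j _ => ?_
  split_ifs
  · rfl
  · simp

variable (hg : IsStagedChart (fieldData L φ) (fun j => chartField φ (b j)) lev (chartDom φ) y₀
  (k + 1) F g) (h : IsAdaptedBasis (lieSeq L Γ) k b c lev)

include hg in
theorem chartInv_mem_pulledSource {y : Fin n → ℝ} (hy : y ∈ g.source) :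
    chartInv φ y ∈ pulledSource φ g :=
  ⟨chartInv_mem_source (hg.source_subset hy), by
    rw [mem_preimage, chartFun_chartInv (hg.source_subset hy)]; exact hy⟩

include hg h in
theorem isElementary_stageQ (i : Fin (k + 1)) (ζ : stageDual L Γ k i) :
    IsElementary (available (fieldData L φ) F (i + 1))
      {y : Fin n → ℝ | WithLp.toLp 2 y ∈ φ.target ∧
        φ.symm (WithLp.toLp 2 y) ∈ pulledSource φ g}
      (fun y => h.stageQ (pulledCoord φ g) i ζ (φ.symm (WithLp.toLp 2 y))) := by
  rw [pulledSource, setOf_chartInv_mem hg.source_subset]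
  refine (IsElementary.sum g.open_source Finset.univ (u := fun j y => (if hj : lev j = i then
      ζ.1 ⟨b j, h.basis_mem i (Nat.lt_succ_iff.1 i.2) j hj.ge⟩ else 0) * g y j)
      fun j _ => ?_).congr fun y hy => ?_
  · by_cases hj : lev j = i
    · refine IsElementary.const_mul _ ((hg.isElementary j).mono (available_mono ?_))
      rw [hj]
      exact min_le_left _ _
    · simpa [hj] using IsElementary.const _ g.open_source
  · have h1 : chartFun φ (φ.symm (WithLp.toLp 2 y)) = y :=
      chartFun_chartInv (hg.source_subset hy)
    simp only [h.stageQ_apply, pulledCoord, h1]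

section Smooth

variable (hφ : φ ∈ IsManifold.maximalAtlas 𝓘(ℝ, Eu n) ∞ M)
include hg hφ

theorem contMDiffOn_comp_chartFun :
    ContMDiffOn 𝓘(ℝ, Eu n) 𝓘(ℝ, Fin n → ℝ) ∞ (fun x => g (chartFun φ x)) (pulledSource φ g) :=
  hg.contDiffOn.contMDiffOn.comp ((contMDiffOn_chartFun hφ).mono inter_subset_left) inter_subset_right

theorem contMDiffOn_sum_pulledCoord (a : Fin n → ℝ) :
    ContMDiffOn 𝓘(ℝ, Eu n) 𝓘(ℝ, ℝ) ∞ (fun x => ∑ j, a j * pulledCoord φ g j x)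
      (pulledSource φ g) := by
  have hT : ContDiff ℝ ∞ fun w : Fin n → ℝ => ∑ j, a j * w j := by fun_prop
  exact hT.contMDiff.comp_contMDiffOn (contMDiffOn_comp_chartFun hg hφ)

include h

theorem fderiv_chartField_apply {y : Fin n → ℝ} (hy : y ∈ g.source) {m : Fin n} {X : VecField n M}
    (hX : X ∈ lieSeq L Γ (lev m)) : fderiv ℝ g y (chartField φ X y) m = c m X := by
  have hyD := hg.source_subset hy
  conv_lhs => rw [← h.sum_coord_smul _ (h.lev_le m) X hX, chartField_sum hφ _ _ hyD, map_sum,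
    Finset.sum_apply, Finset.sum_congr rfl fun j _ => by
      rw [chartField_smul hφ _ _ hyD, map_smul, Pi.smul_apply]]
  rw [Finset.sum_eq_single m]
  · rw [hg.fderiv_apply m (Nat.lt_succ_iff.2 (h.lev_le m)) m le_rfl y hy]
    simp
  · intro j _ hj
    by_cases hjm : lev m ≤ lev j
    · rw [hg.fderiv_apply m (Nat.lt_succ_iff.2 (h.lev_le m)) j hjm y hy]
      simp [hj]
    · rw [h.coord_eq_zero _ (h.lev_le m) X hX j (not_le.1 hjm), zero_smul]
  · simp

/-- Membership is asked only where the coefficient is nonzero, so that this covers both the forms of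
one stage on `L_i` and arbitrary combinations on `Γ`, which lies in every `L_i`. -/
theorem along_sum_pulledCoord (a : Fin n → ℝ) (X : VecField n M) {x : M}
    (hx : x ∈ pulledSource φ g) (hX : ∀ j, a j ≠ 0 → X ∈ lieSeq L Γ (lev j)) :
    along X (fun x => ∑ j, a j * pulledCoord φ g j x) x = ∑ j, a j * c j X := by
  have hgd := OpenPartialHomeomorph.hasFDerivAt_of_contDiffOn hg.contDiffOn hx.2
  let T : (Fin n → ℝ) →L[ℝ] ℝ := ∑ j, a j • ContinuousLinearMap.proj j
  have hT : ∀ w, T w = ∑ j, a j * w j := fun w => by simp [T]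
  have h1 := T.hasFDerivAt.comp _ hgd
  have h2 : (fun x => ∑ j, a j * pulledCoord φ g j x) =
      fun x => (T ∘ g) (chartFun φ x) := by
    funext x
    rw [Function.comp_apply, hT]
    rfl
  rw [h2, along_comp_chartFun hφ X hx.1 h1.differentiableAt, h1.fderiv,
    ContinuousLinearMap.comp_apply, hT]
  refine Finset.sum_congr rfl fun j _ => ?_
  by_cases hj : a j = 0
  · simp [hj]
  · rw [fderiv_chartField_apply hg h hφ hx.2 (hX j hj)]

theorem along_stageQ (i : Fin (k + 1)) (ζ : stageDual L Γ k i) (X : lieSeq L Γ i) {x : M}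
    (hx : x ∈ pulledSource φ g) : along X.1 (h.stageQ (pulledCoord φ g) i ζ) x = ζ.1 X := by
  have h1 : h.stageQ (pulledCoord φ g) i ζ = _ := funext (h.stageQ_apply (pulledCoord φ g) i ζ)
  rw [h1, along_sum_pulledCoord hg h hφ _ _ hx fun j hj => ?_,
    h.apply_eq_sum (Nat.lt_succ_iff.1 i.2)]
  · refine Finset.sum_congr rfl fun j _ => ?_
    split_ifs
    · rfl
    · exact zero_mul _
  · have : lev j = i := by
      by_contra hji
      exact hj (dif_neg hji)
    rw [this]
    exact X.2

theorem along_totalQ (hΓ : Γ ∈ L) (ξ : StageSum L Γ k) {x : M} (hx : x ∈ pulledSource φ g) :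
    along Γ (totalQ (h.stageQ (pulledCoord φ g)) ξ) x = evalAt hΓ ξ := by
  have h1 : totalQ (h.stageQ (pulledCoord φ g)) ξ = _ :=
    funext (h.totalQ_stageQ (pulledCoord φ g) ξ)
  rw [h1, along_sum_pulledCoord hg h hφ _ _ hx fun j _ => mem_lieSeq hΓ _, h.evalAt_eq_sum]

variable [IsManifold 𝓘(ℝ, Eu n) ∞ M]

theorem exists_chart_totalQ (β : Module.Basis (Fin n) ℝ (StageSum L Γ k)) :
    ∃ ψ ∈ IsManifold.maximalAtlas 𝓘(ℝ, Eu n) ∞ M, ψ.source = pulledSource φ g ∧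
      ∀ x ∈ pulledSource φ g, ∀ j, ψ x j = totalQ (h.stageQ (pulledCoord φ g)) (β j) x := by
  let T₀ : (Fin n → ℝ) →L[ℝ] (Fin n → ℝ) :=
    .pi fun j => ∑ m, h.values (β j) m • ContinuousLinearMap.proj m
  have hT₀ : ∀ w j, T₀ w j = ∑ m, h.values (β j) m * w m := fun w j => by simp [T₀]
  have hinj : Function.Injective T₀ := by
    rw [injective_iff_map_eq_zero]
    intro w hw
    -- A vector `w` in the kernel gives a functional on `Ξ` that vanishes on a basis, hence
    -- everywhere. As the values of `ξ` are arbitrary, `w = 0`.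
    let ℓ : StageSum L Γ k →ₗ[ℝ] ℝ := (∑ m, w m • LinearMap.proj m).comp h.values
    have hℓ : ∀ ξ, ℓ ξ = ∑ m, h.values ξ m * w m := fun ξ => by simp [ℓ, mul_comm]
    have hℓ0 : ℓ = 0 := β.ext fun j => by
      rw [hℓ, ← hT₀, hw]
      rfl
    funext m
    obtain ⟨ξ, hξ⟩ := h.values_bijective.2 (Pi.single m 1)
    have := hℓ ξ
    rw [hℓ0, hξ] at this
    simpa [Pi.single_apply] using this.symm
  obtain ⟨T, hT⟩ := ContinuousLinearMap.isInvertible_of_injective hinj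
  let E2 := EuclideanSpace.equiv (Fin n) ℝ
  let ψ : OpenPartialHomeomorph M (Eu n) :=
    ((φ.transHomeomorph E2.toHomeomorph).trans g).transHomeomorph (T.trans E2.symm).toHomeomorph
  have hψ : ∀ x, ψ x = E2.symm (T (g (chartFun φ x))) := fun x => rfl
  have hψs : ∀ z, ψ.symm z = chartInv φ (g.symm (T.symm (E2 z))) := fun z => rfl
  have hsrc : ψ.source = pulledSource φ g := rfl
  refine ⟨ψ, ψ.mem_maximalAtlas_of_contMDiffOn ?_ ?_, hsrc, fun x hx j => ?_⟩
  · have h1 : ContDiff ℝ ∞ fun w => E2.symm (T w) := by fun_prop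
    exact h1.contMDiff.comp_contMDiffOn (contMDiffOn_comp_chartFun hg hφ)
  · have h1 : ContDiff ℝ ∞ fun z => T.symm (E2 z) := by fun_prop
    have hmem : ∀ z ∈ ψ.target, T.symm (E2 z) ∈ g.target := fun z hz => by
      have := ψ.map_target hz
      have h2 : z = ψ (ψ.symm z) := (ψ.right_inv hz).symm
      rw [h2, hψ, E2.apply_symm_apply, T.symm_apply_apply]
      exact g.map_source this.2
    refine ((contMDiffOn_chartInv hφ).comp hg.contDiffOn_symm.contMDiffOn fun w hw =>
      hg.source_subset (g.map_target hw)).comp h1.contMDiff.contMDiffOn hmem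
  · rw [h.totalQ_stageQ, hψ]
    have h1 : T (g (chartFun φ x)) j = T₀ (g (chartFun φ x)) j := by rw [← hT]; rfl
    exact h1.trans (hT₀ _ _)

end Smooth

end Assembly

/-! ### The flow of `Γ` as a translation in the final coordinates. -/

section Flow

variable {n : ℕ} {M : Type*} [TopologicalSpace M] [ChartedSpace (Eu n) M]
  {L : Submodule ℝ (VecField n M)} {Γ : VecField n M} {k : ℕ} {b : Fin n → VecField n M}
  {c : Fin n → VecField n M →ₗ[ℝ] ℝ} {lev : Fin n → ℕ} {φ : OpenPartialHomeomorph M (Eu n)}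
  {y₀ : Fin n → ℝ} {F : ℕ → LocFun} {g : OpenPartialHomeomorph (Fin n → ℝ) (Fin n → ℝ)}

/-- The translation by `t v` in the coordinates `g ∘ φ`. -/
def pulledFlow (φ : OpenPartialHomeomorph M (Eu n))
    (g : OpenPartialHomeomorph (Fin n → ℝ) (Fin n → ℝ)) (v : Fin n → ℝ) (t : ℝ) (x : M) : M :=
  chartInv φ (g.symm (g (chartFun φ x) + t • v))

variable (hg : IsStagedChart (fieldData L φ) (fun j => chartField φ (b j)) lev (chartDom φ) y₀
  (k + 1) F g) (h : IsAdaptedBasis (lieSeq L Γ) k b c lev)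

include hg in
theorem apply_chartFun_pulledFlow {v : Fin n → ℝ} {t : ℝ} {x : M}
    (ht : g (chartFun φ x) + t • v ∈ g.target) :
    g (chartFun φ (pulledFlow φ g v t x)) = g (chartFun φ x) + t • v := by
  rw [pulledFlow, chartFun_chartInv (hg.source_subset (g.map_target ht)), g.right_inv ht]

include hg in
theorem pulledFlow_mem {v : Fin n → ℝ} {t : ℝ} {x : M}
    (ht : g (chartFun φ x) + t • v ∈ g.target) : pulledFlow φ g v t x ∈ pulledSource φ g :=
  chartInv_mem_pulledSource hg (g.map_target ht)

include hg in
theorem totalQ_pulledFlow {v : Fin n → ℝ} (hv : v = fun j => c j Γ) (hΓ : Γ ∈ L) {t : ℝ} {x : M}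
    (ht : g (chartFun φ x) + t • v ∈ g.target) (ξ : StageSum L Γ k) :
    totalQ (h.stageQ (pulledCoord φ g)) ξ (pulledFlow φ g v t x) =
      totalQ (h.stageQ (pulledCoord φ g)) ξ x + evalAt hΓ ξ * t := by
  simp only [h.totalQ_stageQ, h.evalAt_eq_sum, Finset.sum_mul, pulledCoord,
    apply_chartFun_pulledFlow hg ht, ← Finset.sum_add_distrib]
  refine Finset.sum_congr rfl fun j _ => ?_
  simp only [hv, Pi.add_apply, Pi.smul_apply, smul_eq_mul]
  ring

theorem IsStagedChart.isElementary_pulledFlow (v : Fin n → ℝ) {ε : ℝ} {W : Set (Fin n → ℝ)} (hW : IsOpen W)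
    (hWg : W ⊆ g.source) (hε : ∀ y ∈ W, ∀ t ∈ Ioo (-ε) ε, g y + t • v ∈ g.target) (j : Fin n)
    (hg : IsStagedChart (fieldData L φ) (fun j => chartField φ (b j)) lev (chartDom φ) y₀
      (k + 1) F g) :
    IsElementary (available (fieldData L φ) F (k + 1))
      {z : Fin (n + 1) → ℝ | z 0 ∈ Ioo (-ε) ε ∧ WithLp.toLp 2 (Fin.tail z) ∈ φ.target ∧
        φ.symm (WithLp.toLp 2 (Fin.tail z)) ∈ φ.source ∩ chartFun φ ⁻¹' W}
      (fun z => φ (pulledFlow φ g v (z 0) (φ.symm (WithLp.toLp 2 (Fin.tail z)))) j) := by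
  have hWD := hWg.trans hg.source_subset
  have hset : {z : Fin (n + 1) → ℝ | z 0 ∈ Ioo (-ε) ε ∧ WithLp.toLp 2 (Fin.tail z) ∈ φ.target ∧
        φ.symm (WithLp.toLp 2 (Fin.tail z)) ∈ φ.source ∩ chartFun φ ⁻¹' W} =
      {z | z 0 ∈ Ioo (-ε) ε ∧ (Fin.tail z : Fin n → ℝ) ∈ W} := by
    ext z
    have : WithLp.toLp 2 (Fin.tail z) ∈ φ.target ∧
        φ.symm (WithLp.toLp 2 (Fin.tail z)) ∈ φ.source ∩ chartFun φ ⁻¹' W ↔ Fin.tail z ∈ W :=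
      Set.ext_iff.1 (setOf_chartInv_mem hWD) (Fin.tail z)
    exact and_congr_right fun _ => this
  have htail : Continuous fun z : Fin (n + 1) → ℝ => (Fin.tail z : Fin n → ℝ) := by
    unfold Fin.tail
    fun_prop
  have hO : IsOpen {z : Fin (n + 1) → ℝ | z 0 ∈ Ioo (-ε) ε ∧ Fin.tail z ∈ W} :=
    (isOpen_Ioo.preimage (continuous_apply 0)).inter (hW.preimage htail)
  rw [hset]
  have hge : ∀ m, IsElementary (available (fieldData L φ) F (k + 1)) g.source (fun y => g y m) :=
    fun m => (hg.isElementary m).mono (available_mono (min_le_right _ _))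
  have hinv := IsElementary.inverse g hge (fun x hx =>
    OpenPartialHomeomorph.isInvertible_fderiv hg.contDiffOn hg.contDiffOn_symm hx) j
  have hcomp : ∀ m, IsElementary (available (fieldData L φ) F (k + 1))
      {z : Fin (n + 1) → ℝ | z 0 ∈ Ioo (-ε) ε ∧ Fin.tail z ∈ W}
      (fun z => (g (Fin.tail z) + z 0 • v) m) := fun m =>
    (IsElementary.comp hO (hge m) (u := fun a z => z (Fin.succ a)) (fun a => .coord _ hO)
      fun z hz => hWg hz.2).add ((IsElementary.coord 0 hO).mul (.const (v m) hO))
  refine (IsElementary.comp hO hinv hcomp fun z hz => hε _ hz.2 _ hz.1).congr fun z hz => ?_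
  have h1 : chartFun φ (φ.symm (WithLp.toLp 2 (Fin.tail z))) = Fin.tail z :=
    chartFun_chartInv (hWD hz.2)
  have h2 := chartFun_chartInv (φ := φ)
    (hg.source_subset (g.map_target (hε _ hz.2 _ hz.1)))
  change _ = chartFun φ (pulledFlow φ g v (z 0) (φ.symm (WithLp.toLp 2 (Fin.tail z)))) j
  rw [pulledFlow, h1, h2]

variable (hφ : φ ∈ IsManifold.maximalAtlas 𝓘(ℝ, Eu n) ∞ M)
include hg h hφ

theorem fderiv_chartField_dynamics (hΓ : Γ ∈ L) {y : Fin n → ℝ} (hy : y ∈ g.source) :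
    fderiv ℝ g y (chartField φ Γ y) = fun j => c j Γ :=
  funext fun _ => fderiv_chartField_apply hg h hφ hy (mem_lieSeq hΓ _)

theorem isMIntegralCurveOn_pulledFlow (hΓ : Γ ∈ L) {v : Fin n → ℝ} (hv : v = fun j => c j Γ)
    {s : Set ℝ} {x : M} (hs : ∀ t ∈ s, g (chartFun φ x) + t • v ∈ g.target) :
    IsMIntegralCurveOn (fun t => pulledFlow φ g v t x) Γ s := by
  intro t ht
  have hw := hs t ht
  have hy := g.map_target hw
  have hyD := hg.source_subset hy
  have h1 : HasDerivAt (fun t : ℝ => g (chartFun φ x) + t • v) v t := by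
    simpa using! ((hasDerivAt_id t).smul_const v).const_add (g (chartFun φ x))
  have h2 := (OpenPartialHomeomorph.hasFDerivAt_of_contDiffOn (g := g.symm) hg.contDiffOn_symm
    hw).comp_hasDerivAt t h1
  have h3 : fderiv ℝ g.symm (g (chartFun φ x) + t • v) v =
      chartField φ Γ (g.symm (g (chartFun φ x) + t • v)) := by
    have h4 := OpenPartialHomeomorph.fderiv_symm_comp_fderiv hg.contDiffOn hg.contDiffOn_symm hy
    have h5 := congr($h4 (chartField φ Γ (g.symm (g (chartFun φ x) + t • v))))
    rw [ContinuousLinearMap.comp_apply, fderiv_chartField_dynamics hg h hφ hΓ hy, ← hv,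
      g.right_inv hw] at h5
    exact h5
  rw [h3] at h2
  have h6 := (hasMFDerivAt_chartInv hφ hyD).comp t h2.hasFDerivAt.hasMFDerivAt
  refine HasMFDerivAt.hasMFDerivWithinAt (h6.congr_mfderiv ?_)
  refine ContinuousLinearMap.ext_ring ?_
  have h7 := mfderiv_chartInv_chartField hφ Γ hyD
  change mfderiv 𝓘(ℝ, Fin n → ℝ) 𝓘(ℝ, Eu n) (chartInv φ) (g.symm (g (chartFun φ x) + t • v))
    ((1 : ℝ) • chartField φ Γ (g.symm (g (chartFun φ x) + t • v))) =
      (1 : ℝ) • Γ (chartInv φ (g.symm (g (chartFun φ x) + t • v)))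
  rw [one_smul, one_smul, h7]

/-- In the coordinates, the curve minus `t • v` has zero derivative on an interval and so is
constant. Since the curve stays in the coordinate domain, `M` need not be Hausdorff. -/
theorem eq_pulledFlow_of_isMIntegralCurveOn (hΓ : Γ ∈ L) {v : Fin n → ℝ}
    (hv : v = fun j => c j Γ) {γ : ℝ → M} {δ : ℝ} (hδ : 0 < δ)
    (hγU : ∀ t ∈ Ioo (-δ) δ, γ t ∈ pulledSource φ g)
    (hγ : IsMIntegralCurveOn γ Γ (Ioo (-δ) δ)) {t : ℝ} (ht : t ∈ Ioo (-δ) δ) :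
    γ t = pulledFlow φ g v t (γ 0) := by
  have hder : ∀ t ∈ Ioo (-δ) δ,
      HasDerivAt (fun t => g (chartFun φ (γ t)) - t • v) 0 t := fun t ht => by
    have hU := hγU t ht
    have h1 : HasMFDerivAt 𝓘(ℝ, ℝ) 𝓘(ℝ, Eu n) γ t
        ((1 : ℝ →L[ℝ] ℝ).smulRight (Γ (γ t))) :=
      (hγ t ht).hasMFDerivAt (isOpen_Ioo.mem_nhds ht)
    have h2 := (hasMFDerivAt_chartFun hφ hU.1).comp t h1
    have h3 := (OpenPartialHomeomorph.hasFDerivAt_of_contDiffOn hg.contDiffOn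
      hU.2).hasMFDerivAt.comp t h2
    have h4 : HasDerivAt (fun t => g (chartFun φ (γ t))) v t := by
      let G : Eu n →L[ℝ] (Fin n → ℝ) :=
        mfderiv 𝓘(ℝ, Eu n) 𝓘(ℝ, Fin n → ℝ) (chartFun φ) (γ t)
      let D : ℝ →L[ℝ] (Fin n → ℝ) := (fderiv ℝ g (chartFun φ (γ t))).comp
        (G.comp ((1 : ℝ →L[ℝ] ℝ).smulRight (Γ (γ t) : Eu n)))
      have h5 : HasFDerivAt (fun t => g (chartFun φ (γ t))) D t := h3.hasFDerivAt
      refine h5.hasDerivAt.congr_deriv ?_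
      rw [hv, ← fderiv_chartField_dynamics hg h hφ hΓ hU.2,
        chartField_eq_mfderiv hφ Γ (chartFun_mem_chartDom hU.1), chartInv_chartFun hU.1]
      change fderiv ℝ g (chartFun φ (γ t)) (G ((1 : ℝ) • (Γ (γ t) : Eu n))) = _
      rw [one_smul]
      rfl
    have h5 : HasDerivAt (fun t : ℝ => t • v) v t := by
      simpa using! (hasDerivAt_id t).smul_const v
    simpa using! h4.sub h5
  have h0 : (0 : ℝ) ∈ Ioo (-δ) δ := ⟨by linarith, hδ⟩
  have hconst := isOpen_Ioo.is_const_of_deriv_eq_zero isPreconnected_Ioo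
    (fun t ht => (hder t ht).differentiableAt.differentiableWithinAt)
    (fun t ht => (hder t ht).deriv) ht h0
  have hU := hγU t ht
  have h1 : g (chartFun φ (γ 0)) + t • v = g (chartFun φ (γ t)) := by
    have : g (chartFun φ (γ t)) - t • v = g (chartFun φ (γ 0)) := by simpa using hconst
    rw [← this]
    simp
  rw [pulledFlow, h1, g.left_inv hU.2, chartInv_chartFun hU.1]

end Flow

end

/-! ### The theorem. -/

theorem mainTheorem1 (n : ℕ) (M : Type*) [TopologicalSpace M] [ChartedSpace (Eu n) M]
    [IsManifold 𝓘(ℝ, Eu n) ∞ M]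
    (L : Submodule ℝ (VecField n M)) (hL : IsFrameLieAlgebra L)
    (Γ : VecField n M) (hΓ : Γ ∈ L)
    (k : ℕ) (hk : IsAbelianSpace (lieSeq L Γ k))
    -- an arbitrary point and arbitrary initial coordinates around it
    (x₀ : M) (φ : OpenPartialHomeomorph M (Eu n))
    (hφ : φ ∈ IsManifold.maximalAtlas 𝓘(ℝ, Eu n) ∞ M) (hx₀ : x₀ ∈ φ.source) :
    ∃ (U : Set M) (Q : (i : Fin (k + 1)) → stageDual L Γ k i →ₗ[ℝ] (M → ℝ)) (F : ℕ → LocFun),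
      IsOpen U ∧ x₀ ∈ U ∧ U ⊆ φ.source ∧
      -- `F` lists the results of the `k + 1` quadratures that are performed
      IsQuadratureSequence (fieldData L φ) (k + 1) F ∧
      -- the functions `Q_ζ`, the ones of stage `i` being obtained by the first `i + 1` quadratures
      (∀ (i : Fin (k + 1)) (ζ : stageDual L Γ k i),
        ContMDiffOn 𝓘(ℝ, Eu n) 𝓘(ℝ, ℝ) ∞ (Q i ζ) U ∧
        (∀ X : lieSeq L Γ i, ∀ x ∈ U, along X.1 (Q i ζ) x = ζ.1 X) ∧
        IsElementary (available (fieldData L φ) F (i + 1))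
          {y : Fin n → ℝ | WithLp.toLp 2 y ∈ φ.target ∧ φ.symm (WithLp.toLp 2 y) ∈ U}
          (fun y => Q i ζ (φ.symm (WithLp.toLp 2 y)))) ∧
      -- any basis of `Ξ` gives coordinates on `U`, and in them `Γ` has constant components
      Nonempty (Module.Basis (Fin n) ℝ (StageSum L Γ k)) ∧
      (∀ b : Module.Basis (Fin n) ℝ (StageSum L Γ k),
        ∃ ψ ∈ IsManifold.maximalAtlas 𝓘(ℝ, Eu n) ∞ M,
          ψ.source = U ∧ ∀ x ∈ U, ∀ j, ψ x j = totalQ Q (b j) x) ∧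
      (∀ (ξ : StageSum L Γ k), ∀ x ∈ U, along Γ (totalQ Q ξ) x = evalAt hΓ ξ) ∧
      -- the flow of `Γ` near `x₀`, obtained by the `k + 1` quadratures
      ∃ (V : Set M) (ε : ℝ) (Φ : ℝ → M → M),
        IsOpen V ∧ x₀ ∈ V ∧ V ⊆ U ∧ 0 < ε ∧
        (∀ x ∈ V, Φ 0 x = x ∧
          IsMIntegralCurveOn (fun t => Φ t x) Γ (Ioo (-ε) ε) ∧
          ∀ t ∈ Ioo (-ε) ε, Φ t x ∈ U ∧
            ∀ ξ : StageSum L Γ k, totalQ Q ξ (Φ t x) = totalQ Q ξ x + evalAt hΓ ξ * t) ∧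
        (∀ (γ : ℝ → M) (δ : ℝ), 0 < δ → δ ≤ ε → γ 0 ∈ V → (∀ t ∈ Ioo (-δ) δ, γ t ∈ U) →
          IsMIntegralCurveOn γ Γ (Ioo (-δ) δ) → ∀ t ∈ Ioo (-δ) δ, γ t = Φ t (γ 0)) ∧
        ∀ j : Fin n, IsElementary (available (fieldData L φ) F (k + 1))
          {z : Fin (n + 1) → ℝ | z 0 ∈ Ioo (-ε) ε ∧
            WithLp.toLp 2 (Fin.tail z) ∈ φ.target ∧ φ.symm (WithLp.toLp 2 (Fin.tail z)) ∈ V}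
          (fun z => φ (Φ (z 0) (φ.symm (WithLp.toLp 2 (Fin.tail z)))) j) := by
  have : FiniteDimensional ℝ (lieSeq L Γ 0) := hL.finiteDimensional
  obtain ⟨b, c, lev, h⟩ := exists_isAdaptedBasis (k := k)
    (fun i _ => lieSeq_succ_le hL hΓ i) hL.finrank_eq
  obtain ⟨F, g, hF, hg⟩ := exists_isStagedChart_chartField hL h hφ hΓ hk hx₀
  have hg₀ : g (chartFun φ x₀) = 0 := hg.map_eq_zero
  have hx₀U : x₀ ∈ pulledSource φ g := ⟨hx₀, hg.mem_source⟩
  refine ⟨pulledSource φ g, h.stageQ (pulledCoord φ g), F,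
    isOpen_source_inter_chartFun_preimage g.open_source, hx₀U, inter_subset_left, hF,
    fun i ζ => ⟨?_, fun X x hx => along_stageQ hg h hφ i ζ X hx, isElementary_stageQ hg h i ζ⟩,
    ⟨(Pi.basisFun ℝ (Fin n)).map (LinearEquiv.ofBijective h.values h.values_bijective).symm⟩,
    exists_chart_totalQ hg h hφ, fun ξ x hx => along_totalQ hg h hφ hΓ ξ hx, ?_⟩
  · exact (contMDiffOn_sum_pulledCoord hg hφ _).congr fun x _ => h.stageQ_apply _ i ζ x
  obtain ⟨r, hr, hrg⟩ := Metric.isOpen_iff.1 g.open_target 0 hg.zero_mem_target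
  set v : Fin n → ℝ := fun j => c j Γ with hv
  set W := g.source ∩ g ⁻¹' Metric.ball 0 (r / 2) with hW
  have hWo : IsOpen W := g.isOpen_inter_preimage Metric.isOpen_ball
  -- Starting points have coordinates of norm less than `r / 2`, and for `|t| < ε` the displacement
  -- `t • v` has norm at most `r / 2`, so the translate stays in the ball of radius `r`. The summand
  -- `1` allows `v = 0`.
  set ε := r / 2 / (‖v‖ + 1) with hε
  have hv1 : 0 < ‖v‖ + 1 := by positivity
  have hmem : ∀ y ∈ W, ∀ t ∈ Ioo (-ε) ε, g y + t • v ∈ g.target := fun y hy t ht => by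
    apply hrg
    have h1 : ‖g y‖ < r / 2 := by simpa using hy.2
    have h2 : ‖t • v‖ ≤ r / 2 := by
      rw [norm_smul, Real.norm_eq_abs]
      have h3 : |t| * (‖v‖ + 1) ≤ r / 2 := (le_div_iff₀ hv1).1 (abs_lt.2 ht).le
      nlinarith [abs_nonneg t]
    rw [mem_ball_zero_iff]
    linarith [norm_add_le (g y) (t • v)]
  refine ⟨φ.source ∩ chartFun φ ⁻¹' W, ε, pulledFlow φ g v,
    isOpen_source_inter_chartFun_preimage hWo, ⟨hx₀, hg.mem_source, ?_⟩,
    fun x hx => ⟨hx.1, hx.2.1⟩, by positivity, fun x hx => ⟨?_, ?_, fun t ht => ⟨?_, fun ξ => ?_⟩⟩,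
    fun γ δ hδ _ _ hγU hγ t ht => eq_pulledFlow_of_isMIntegralCurveOn hg h hφ hΓ hv hδ hγU hγ ht,
    fun j => hg.isElementary_pulledFlow v hWo inter_subset_left hmem j⟩
  · rw [mem_preimage, hg₀]
    exact Metric.mem_ball_self (by positivity)
  · rw [pulledFlow, zero_smul, add_zero, g.left_inv hx.2.1, chartInv_chartFun hx.1]
  · exact isMIntegralCurveOn_pulledFlow hg h hφ hΓ hv fun t ht => hmem _ hx.2 t ht
  · exact pulledFlow_mem hg (hmem _ hx.2 t ht)
  · exact totalQ_pulledFlow hg h hv hΓ (hmem _ hx.2 t ht) ξ
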